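/- Let $L>0$, $\Omega=(0,L)$, $T>0$, $1/2<\alpha\le1$, and let $\|\cdot\|$ be the norm of $L_2(\Omega)$ and $\|v\|_2=(\|v\|^2+\|v_x\|^2+\|v_{xx}\|^2)^{1/2}$ that of $H^2(\Omega)$. Put $\omega_\alpha(t)=t^{\alpha-1}/\Gamma(\alpha)$, $I^\alpha v(t)=\int_0^t\omega_\alpha(t-s)v(s)\,ds$, $\partial_t^{1-\alpha}v=(I^\alpha v)_t$ and $E_\alpha(z)=\sum_{m=0}^\infty z^m/\Gamma(1+m\alpha)$. For a uniform step $k=T/N$ let $t_n=nk$, $I_n=(t_{n-1},t_n)$, and for a sequence $(v^n)$ let $\check v(t)=v^n$ for $t\in I_n$. Let $F^n(x)=F(x,t_n)$ belong to $W^1_\infty(\Omega)$ and let $\bar g^n\in L_2(\Omega)$ for $1\le n\le N$. Consider the implicit scheme: $U^n\in H^1_0(\Omega)$ and $$U^n-U^{n-1}-\int_{I_n}\partial_t^{1-\alpha}\check U_{xx}\,dt+\int_{I_n}\bigl(F^n\partial_t^{1-\alpha}\check U\bigr)_x\,dt=k\bar g^n,\qquad 1\le n\le N,$$ understood in the weak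 sense (tested against $H^1_0(\Omega)$, with one $x$-derivative of each flux moved onto the test function). Suppose that $U^0\in H^1_0(\Omega)\cap H^2(\Omega)$ and that $$1+F(x,t_n)^2+F_x(x,t_n)^2\le C_F\qquad\text{for (almost every) }x\in\Omega\text{ and }1\le n\le N.$$ Then there is $k_0>0$, depending only on $\alpha$, $C_F$ and $T$, such that if $k\le k_0$, then for $1\le n\le N$ $$\|U^n-U^0\|^2\le t_n\,E_\alpha\!\left(\frac{C_1t_n^{2\alpha}}{\Gamma(\alpha+1)}\right)\left[C_2\sum_{j=1}^nk\|\bar g^j\|^2+C_3\|U^0\|_2^2\left(1+\frac{t_n^{2\alpha-1}}{2\alpha-1}\right)\right],$$ where $C_1=24C_F(1+2C_F)$, $C_2=6(1+2C_F)$ and $C_3=6C_F(1+4C_F)$. -/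

import Mathlib

noncomputable section

namespace TimeFracFP

open MeasureTheory Filter Topology

/-- The kernel `ω_α(t) = t^(α-1) / Γ(α)`. -/
def omega (α t : ℝ) : ℝ := t ^ (α - 1) / Real.Gamma α

/-- The Mittag-Leffler function `E_β(z) = ∑ zⁿ / Γ(1 + nβ)`. -/
def mittagLeffler (β z : ℝ) : ℝ := ∑' n : ℕ, z ^ n / Real.Gamma (1 + n * β)

/-- The fractional integral `I^α v(t) = ∫₀ᵗ ω_α(t-s) v(s) ds` of a vector-valued function
(a Bochner integral). -/
def fracInt {E : Type*} [NormedAddCommGroup E] [NormedSpace ℝ E] (α : ℝ) (v : ℝ → E) (t : ℝ) : E :=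
  ∫ s in (0 : ℝ)..t, omega α (t - s) • v s

/-- The Riemann-Liouville derivative of order `1 - α`, that is `(I^α v)_t`. -/
def fracDeriv {E : Type*} [NormedAddCommGroup E] [NormedSpace ℝ E] (α : ℝ) (v : ℝ → E) (t : ℝ) : E :=
  deriv (fracInt α v) t

/-- The piecewise-constant interpolant on the uniform mesh `t_n = n k`: it equals `v n` for
`t_{n-1} < t < t_n`, `n ≥ 1`. -/
def check {E : Type*} (k : ℝ) (v : ℕ → E) (t : ℝ) : E := v ⌈t / k⌉₊

/-- Lebesgue measure on `Ω = (0, L)`. -/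
abbrev μ (L : ℝ) : Measure ℝ := volume.restrict (Set.Ioo 0 L)

/-- The Hilbert space `L₂(Ω)`. -/
abbrev L2 (L : ℝ) : Type := Lp ℝ 2 (μ L)

/-- Test functions: smooth functions with compact support in `Ω = (0, L)`. -/
def IsTest (L : ℝ) (φ : ℝ → ℝ) : Prop :=
  ContDiff ℝ (⊤ : ℕ∞) φ ∧ HasCompactSupport φ ∧ tsupport φ ⊆ Set.Ioo 0 L

/-- `v` is the weak derivative of `u` on `Ω = (0, L)`. -/
def HasWeakDeriv (L : ℝ) (u v : ℝ → ℝ) : Prop :=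
  LocallyIntegrableOn u (Set.Ioo 0 L) ∧ LocallyIntegrableOn v (Set.Ioo 0 L) ∧
    ∀ φ : ℝ → ℝ, IsTest L φ →
      ∫ x in Set.Ioo 0 L, u x * deriv φ x = -∫ x in Set.Ioo 0 L, v x * φ x

/-- `u ∈ H¹₀(Ω)` with weak derivative `ux`: `u` belongs to `H¹(Ω)` and is a limit, in the norm of
`H¹(Ω)`, of test functions. -/
def MemH10 (L : ℝ) (u ux : L2 L) : Prop :=
  HasWeakDeriv L u ux ∧
    ∃ φ : ℕ → ℝ → ℝ, (∀ m, IsTest L (φ m)) ∧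
      Tendsto (fun m => eLpNorm (fun x => u x - φ m x) 2 (μ L)) atTop (𝓝 0) ∧
      Tendsto (fun m => eLpNorm (fun x => ux x - deriv (φ m) x) 2 (μ L)) atTop (𝓝 0)

/-- The implicit scheme with uniform step `k`,
`Uⁿ - Uⁿ⁻¹ - ∫_{I_n} ∂_t^{1-α} Ǔ_xx dt + ∫_{I_n} (Fⁿ ∂_t^{1-α} Ǔ)_x dt = k gⁿ` for `1 ≤ n ≤ N`,
with `Fⁿ = F(·, n k)`, `I_n = ((n-1) k, n k)`. The derivatives in `x` of the two fluxes are taken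
in the weak sense (test functions in `H¹₀(Ω)`); `Ux n` is the derivative of `U n ∈ H¹₀(Ω)`. -/
def SolvesScheme (α L k : ℝ) (N : ℕ) (F : ℝ → ℝ → ℝ) (g U Ux : ℕ → L2 L) : Prop :=
  (∀ n ≤ N, MemH10 L (U n) (Ux n)) ∧
  ∀ n : ℕ, 1 ≤ n → n ≤ N → ∀ v vx : L2 L, MemH10 L v vx →
    inner ℝ (U n - U (n - 1)) v
      + inner ℝ (∫ t in (((n : ℝ) - 1) * k)..(n * k), fracDeriv α (check k Ux) t) vx
      - ∫ x in Set.Ioo 0 L, F x (n * k) *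
          (∫ t in (((n : ℝ) - 1) * k)..(n * k), fracDeriv α (check k U) t : L2 L) x * vx x
      = k * inner ℝ (g n) v

end TimeFracFP

end

noncomputable section

open scoped ENNReal

namespace TimeFracFP

open MeasureTheory Filter Topology

/-! The proof is an energy argument on the increments `D m = U (m+1) - U m`. On a piecewise-constant
function the fractional derivative integrates over a cell to a difference of two discrete
convolutions with `weight`; summation by parts turns this into `P m = ∑ w (m-j) • D j` plus `w m • U
0`. Since `U 0` lies in `H²`, its contribution moves to the right-hand side, and the scheme reads
weakly `D - P_xx + (F P)_x = h` with `h = k g + w m (U0xx - (F U0)_x)`.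

Testing with `D` bounds `‖D‖²` up to `⟨P_x, D_x⟩` and multiples of `‖P‖²` and `‖P_x‖²`; testing with
`P` bounds `‖P_x‖²` up to `⟨D, P⟩`. The weights are nonnegative, decreasing and convex, so
convolution with them is of positive type (`sum_inner_conv_nonneg`), and after summation over time
both mixed terms can be dropped. What remains bounds `∑ ‖D‖²` by `∑ ‖h‖²` and `∑ ‖P‖²`.

Cauchy–Schwarz against the weights turns `∑ ‖P‖²` into a discrete fractional integral of the partial
sums of `‖D‖²`, so `fractional_gronwall` applies and produces the Mittag-Leffler factor. Its
argument carries `t_n^(2α)`: one `t_n^α` is the total mass of the weights, the other comes from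
Gronwall. A small step is needed only to absorb the diagonal term of the implicit scheme.

Finally `‖U n - U 0‖² ≤ n ∑ ‖D‖²`, while `∑ ‖h‖²` carries a factor `k` because `ω_α` is square
integrable for `α > 1/2`; together these give `t_n = n k`. -/

/-- The weight `∫_{mk}^{(m+1)k} ω_α`. -/
def weight (α k : ℝ) (m : ℕ) : ℝ := ∫ s in ((m : ℝ) * k)..((m + 1 : ℕ) * k), omega α s

/-! ### The kernel `ω_α` and its cell weights. -/

theorem intervalIntegrable_omega {α : ℝ} (hα : 0 < α) (a b : ℝ) :
    IntervalIntegrable (omega α) volume a b := by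
  unfold omega
  exact (intervalIntegral.intervalIntegrable_rpow' (by linarith)).div_const _

theorem intervalIntegrable_omega_sub_left {α : ℝ} (hα : 0 < α) (t a b : ℝ) :
    IntervalIntegrable (fun s => omega α (t - s)) volume a b := by
  simpa using (intervalIntegrable_omega hα (t - a) (t - b)).comp_sub_left t

theorem intervalIntegrable_omega_sub_right {α : ℝ} (hα : 0 < α) (c a b : ℝ) :
    IntervalIntegrable (fun s => omega α (s - c)) volume a b := by
  simpa using (intervalIntegrable_omega hα (a - c) (b - c)).comp_sub_right c

theorem omega_nonneg {α : ℝ} (hα : 0 < α) {t : ℝ} (ht : 0 ≤ t) : 0 ≤ omega α t :=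
  div_nonneg (Real.rpow_nonneg ht _) (Real.Gamma_pos_of_pos hα).le

theorem omega_anti {α : ℝ} (hα : 0 < α) (hα1 : α ≤ 1) {s t : ℝ} (hs : 0 < s) (hst : s ≤ t) :
    omega α t ≤ omega α s :=
  div_le_div_of_nonneg_right (Real.rpow_le_rpow_of_nonpos hs hst (by linarith))
    (Real.Gamma_pos_of_pos hα).le

/-- By AM-GM the right side dominates twice the geometric mean of its two terms, and `s (s + 2h) ≤
(s + h)²` with a nonpositive exponent finishes. This midpoint convexity is the source of
`weight_convex`. -/
theorem two_mul_omega_le {α : ℝ} (hα : 0 < α) (hα1 : α ≤ 1) {s h : ℝ} (hs : 0 < s) (hh : 0 ≤ h) :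
    2 * omega α (s + h) ≤ omega α s + omega α (s + h + h) := by
  unfold omega
  rw [← add_div, ← mul_div_assoc]
  refine div_le_div_of_nonneg_right ?_ (Real.Gamma_pos_of_pos hα).le
  set p := (α - 1) / 2 with hp
  have hsq : ∀ x : ℝ, 0 < x → x ^ (α - 1) = (x ^ p) ^ 2 := fun x hx => by
    rw [← Real.rpow_natCast, ← Real.rpow_mul hx.le]; congr 1; rw [hp]; push_cast; ring
  have h1 : (s + h) ^ (α - 1) ≤ s ^ p * (s + h + h) ^ p := by
    rw [← Real.mul_rpow hs.le (by linarith)]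
    have : (s + h) ^ (α - 1) = ((s + h) ^ 2) ^ p := by
      rw [← Real.rpow_natCast, ← Real.rpow_mul (by linarith)]; congr 1; rw [hp]; push_cast; ring
    rw [this]
    exact Real.rpow_le_rpow_of_nonpos (by positivity) (by nlinarith) (by rw [hp]; linarith)
  rw [hsq s hs, hsq (s + h + h) (by linarith)]
  nlinarith [sq_nonneg (s ^ p - (s + h + h) ^ p)]

/-- The antiderivative of `ω_α` vanishing at `0`. -/
theorem hasDerivAt_rpow_div_Gamma {α : ℝ} (hα : 0 < α) {t : ℝ} (ht : 0 < t) :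
    HasDerivAt (fun t : ℝ => t ^ α / Real.Gamma (α + 1)) (omega α t) t := by
  have := (Real.hasDerivAt_rpow_const (p := α) (Or.inl ht.ne')).div_const (Real.Gamma (α + 1))
  have e : omega α t = α * t ^ (α - 1) / Real.Gamma (α + 1) := by
    rw [omega, Real.Gamma_add_one hα.ne']
    have := (Real.Gamma_pos_of_pos hα).ne'
    field_simp
  rwa [e]

theorem integral_omega {α : ℝ} (hα : 0 < α) {a b : ℝ} :
    ∫ s in a..b, omega α s = b ^ α / Real.Gamma (α + 1) - a ^ α / Real.Gamma (α + 1) := by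
  unfold omega
  rw [intervalIntegral.integral_div, integral_rpow (Or.inl (by linarith)),
    Real.Gamma_add_one hα.ne']
  have := (Real.Gamma_pos_of_pos hα).ne'
  simp only [sub_add_cancel]
  field_simp

theorem weight_eq {α : ℝ} (hα : 0 < α) (k : ℝ) (m : ℕ) :
    weight α k m = ((m + 1 : ℕ) * k) ^ α / Real.Gamma (α + 1) - (m * k) ^ α / Real.Gamma (α + 1) :=
  integral_omega hα

theorem sum_weight {α : ℝ} (hα : 0 < α) (k : ℝ) (n : ℕ) :
    ∑ m ∈ Finset.range n, weight α k m = (n * k) ^ α / Real.Gamma (α + 1) := by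
  simp_rw [weight_eq hα]
  rw [Finset.sum_range_sub (fun m : ℕ => ((m : ℝ) * k) ^ α / Real.Gamma (α + 1))]
  simp [Real.zero_rpow hα.ne']

theorem weight_eq_shift {α k : ℝ} (m : ℕ) :
    weight α k m = ∫ s in (0 : ℝ)..k, omega α (s + m * k) := by
  rw [intervalIntegral.integral_comp_add_right, weight]
  congr 1 <;> push_cast <;> ring

theorem intervalIntegrable_omega_add_right {α : ℝ} (hα : 0 < α) (c a b : ℝ) :
    IntervalIntegrable (fun s => omega α (s + c)) volume a b := by
  simpa using intervalIntegrable_omega_sub_right hα (-c) a b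

theorem weight_nonneg {α k : ℝ} (hα : 0 < α) (hk : 0 ≤ k) (m : ℕ) : 0 ≤ weight α k m := by
  rw [weight_eq_shift]
  exact intervalIntegral.integral_nonneg hk fun s hs =>
    omega_nonneg hα (add_nonneg hs.1 (by positivity))

theorem weight_succ_le {α k : ℝ} (hα : 0 < α) (hα1 : α ≤ 1) (hk : 0 ≤ k) (m : ℕ) :
    weight α k (m + 1) ≤ weight α k m := by
  rw [weight_eq_shift, weight_eq_shift]
  refine intervalIntegral.integral_mono_on_of_le_Ioo hk
    (intervalIntegrable_omega_add_right hα _ _ _) (intervalIntegrable_omega_add_right hα _ _ _)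
    fun s hs => omega_anti hα hα1 (add_pos_of_pos_of_nonneg hs.1 (by positivity)) ?_
  push_cast; nlinarith

theorem weight_convex {α k : ℝ} (hα : 0 < α) (hα1 : α ≤ 1) (hk : 0 ≤ k) (m : ℕ) :
    weight α k (m + 1) - weight α k (m + 2) ≤ weight α k m - weight α k (m + 1) := by
  have hi := fun c : ℝ => intervalIntegrable_omega_add_right hα c 0 k
  suffices h : 2 * weight α k (m + 1) ≤ weight α k m + weight α k (m + 2) by linarith
  rw [weight_eq_shift, weight_eq_shift, weight_eq_shift, ← intervalIntegral.integral_const_mul,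
    ← intervalIntegral.integral_add (hi _) (hi _)]
  refine intervalIntegral.integral_mono_on_of_le_Ioo hk ((hi _).const_mul 2) ((hi _).add (hi _))
    fun s hs => ?_
  have := two_mul_omega_le hα hα1 (s := s + m * k) (add_pos_of_pos_of_nonneg hs.1 (by positivity)) hk
  convert this using 3 <;> push_cast <;> ring

/-- Cauchy–Schwarz on one cell, with `ω_α² ≤ s^(2α-2)` because `Γ(α) ≥ 1` on `(0,1]`. The right side
is left as a difference so that the sum over cells telescopes. -/
theorem sq_weight_le {α k : ℝ} (hα : 1 / 2 < α) (hα1 : α ≤ 1) (hk : 0 < k) (m : ℕ) :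
    weight α k m ^ 2 ≤
      k * ((((m + 1 : ℕ) * k) ^ (2 * α - 1) - (m * k) ^ (2 * α - 1)) / (2 * α - 1)) := by
  have hα0 : 0 < α := by linarith
  have hΓ : 1 ≤ Real.Gamma α := by
    rw [← Real.Gamma_one]
    exact Real.Gamma_strictAntiOn_Ioc.antitoneOn ⟨hα0, hα1⟩ (by simp) hα1
  have hle : (m : ℝ) * k ≤ (m + 1 : ℕ) * k := by push_cast; nlinarith
  have h0 : (0 : ℝ) ≤ m * k := by positivity
  have hi2 : IntervalIntegrable (fun s : ℝ => s ^ (2 * α - 2)) volume (m * k) ((m + 1 : ℕ) * k) :=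
    intervalIntegral.intervalIntegrable_rpow' (by linarith)
  have hI : ∫ s in ((m : ℝ) * k)..((m + 1 : ℕ) * k), s ^ (2 * α - 2) =
      (((m + 1 : ℕ) * k) ^ (2 * α - 1) - (m * k) ^ (2 * α - 1)) / (2 * α - 1) := by
    rw [integral_rpow (Or.inl (by linarith))]; ring_nf
  rw [← hI]
  set w := weight α k m with hw
  -- Cauchy–Schwarz obtained by integrating `(ω_α - w/k)² ≥ 0`, where `w/k` is the mean of `ω_α` on
  -- the cell.
  have key : ∫ s in ((m : ℝ) * k)..((m + 1 : ℕ) * k), (2 * (w / k) * omega α s - (w / k) ^ 2) ≤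
      ∫ s in ((m : ℝ) * k)..((m + 1 : ℕ) * k), s ^ (2 * α - 2) := by
    refine intervalIntegral.integral_mono_on_of_le_Ioo hle
      (((intervalIntegrable_omega hα0 _ _).const_mul _).sub intervalIntegrable_const) hi2
      fun s hs => ?_
    have hs0 : 0 < s := h0.trans_lt hs.1
    have h1 : omega α s ^ 2 ≤ s ^ (2 * α - 2) := by
      have : s ^ (2 * α - 2) = (s ^ (α - 1)) ^ 2 := by
        rw [← Real.rpow_natCast, ← Real.rpow_mul hs0.le]; congr 1; push_cast; ring
      rw [this, omega]
      have h2 : 0 ≤ s ^ (α - 1) := by positivity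
      exact pow_le_pow_left₀ (by positivity) (div_le_self h2 hΓ) 2
    nlinarith [sq_nonneg (omega α s - w / k)]
  rw [intervalIntegral.integral_sub ((intervalIntegrable_omega hα0 _ _).const_mul _)
    intervalIntegrable_const, intervalIntegral.integral_const_mul,
    intervalIntegral.integral_const] at key
  rw [← weight, ← hw] at key
  have h3 : 2 * (w / k) * w - (((m + 1 : ℕ) : ℝ) * k - m * k) • (w / k) ^ 2 = w ^ 2 / k := by
    rw [smul_eq_mul]; push_cast; field_simp; ring
  rw [h3, div_le_iff₀ hk] at key
  linarith

theorem sum_sq_weight_le {α k : ℝ} (hα : 1 / 2 < α) (hα1 : α ≤ 1) (hk : 0 < k) (n : ℕ) :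
    ∑ m ∈ Finset.range n, weight α k m ^ 2 ≤ k * ((n * k) ^ (2 * α - 1) / (2 * α - 1)) := by
  refine (Finset.sum_le_sum fun m _ => sq_weight_le hα hα1 hk m).trans ?_
  rw [← Finset.mul_sum, ← Finset.sum_div,
    Finset.sum_range_sub (fun m : ℕ => ((m : ℝ) * k) ^ (2 * α - 1))]
  simp [Real.zero_rpow (show 2 * α - 1 ≠ 0 by linarith)]

/-! ### The fractional derivative of a piecewise-constant function. -/

theorem check_eq {E : Type*} {k : ℝ} (hk : 0 < k) (v : ℕ → E) {j : ℕ} {s : ℝ}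
    (hs : s ∈ Set.Ioc ((j : ℝ) * k) ((j + 1 : ℕ) * k)) : check k v s = v (j + 1) := by
  unfold check
  congr 1
  rw [Nat.ceil_eq_iff (by omega)]
  refine ⟨?_, ?_⟩
  · simpa using (lt_div_iff₀ hk).2 hs.1
  · exact (div_le_iff₀ hk).2 hs.2

section Interpolant
variable {E : Type*} [NormedAddCommGroup E] [NormedSpace ℝ E]

theorem intervalIntegrable_smul_const {f : ℝ → ℝ} {a b : ℝ} (hf : IntervalIntegrable f volume a b)
    (c : E) : IntervalIntegrable (fun s => f s • c) volume a b :=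
  ⟨Integrable.smul_const hf.1 c, Integrable.smul_const hf.2 c⟩

variable [CompleteSpace E]

theorem integral_omega_smul_check {α k : ℝ} (hα : 0 < α) (hk : 0 < k) (v : ℕ → E) {j : ℕ}
    {t a : ℝ} (ha : (j : ℝ) * k ≤ a) (ha' : a ≤ (j + 1 : ℕ) * k) :
    IntervalIntegrable (fun s => omega α (t - s) • check k v s) volume (j * k) a ∧
    ∫ s in ((j : ℝ) * k)..a, omega α (t - s) • check k v s =
      ((t - j * k) ^ α / Real.Gamma (α + 1) - (t - a) ^ α / Real.Gamma (α + 1)) • v (j + 1) := by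
  have heq : Set.EqOn (fun s => omega α (t - s) • v (j + 1))
      (fun s => omega α (t - s) • check k v s) (Set.uIoc ((j : ℝ) * k) a) := fun s hs => by
    rw [Set.uIoc_of_le ha] at hs
    simp only
    rw [check_eq hk v ⟨hs.1, hs.2.trans ha'⟩]
  refine ⟨(intervalIntegrable_smul_const
    (intervalIntegrable_omega_sub_left hα t _ _) (v (j + 1))).congr heq, ?_⟩
  rw [← intervalIntegral.integral_congr_ae (Eventually.of_forall heq), intervalIntegral.integral_smul_const,
    intervalIntegral.integral_comp_sub_left (fun s => omega α s), integral_omega hα]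

theorem fracInt_check {α k : ℝ} (hα : 0 < α) (hk : 0 < k) (v : ℕ → E) {m : ℕ} {t : ℝ}
    (ht : (m : ℝ) * k ≤ t) (ht' : t ≤ (m + 1 : ℕ) * k) :
    fracInt α (check k v) t = ∑ j ∈ Finset.range m, ((t - j * k) ^ α / Real.Gamma (α + 1) -
      (t - (j + 1 : ℕ) * k) ^ α / Real.Gamma (α + 1)) • v (j + 1) +
      ((t - m * k) ^ α / Real.Gamma (α + 1)) • v (m + 1) := by
  have hstep : ∀ j : ℕ, (j : ℝ) * k ≤ (j + 1 : ℕ) * k := fun j => by push_cast; nlinarith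
  have h1 : ∀ j < m, IntervalIntegrable (fun s => omega α (t - s) • check k v s) volume
      ((j : ℝ) * k) ((j + 1 : ℕ) * k) := fun j _ =>
    (integral_omega_smul_check hα hk v (hstep j) le_rfl).1
  have h2 := integral_omega_smul_check hα hk v (t := t) ht ht'
  have h3 := IntervalIntegrable.trans_iterate (a := fun j : ℕ => (j : ℝ) * k) h1
  rw [fracInt, ← intervalIntegral.integral_add_adjacent_intervals (b := (m : ℝ) * k)
    (by simpa using h3) h2.1, h2.2]
  have h4 := intervalIntegral.sum_integral_adjacent_intervals (a := fun j : ℕ => (j : ℝ) * k) h1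
  simp only [Nat.cast_zero, zero_mul] at h4
  rw [← h4]
  congr 1
  · exact Finset.sum_congr rfl fun j _ =>
      (integral_omega_smul_check hα hk v (hstep j) le_rfl).2
  · simp [Real.zero_rpow hα.ne']

/-- Inside the cell the fractional integral is a combination `G` of shifted powers. Its derivative
may blow up at the left endpoint but is integrable, and `G` is continuous on the closed cell, so the
integral is the difference of the end values of `G`. -/
theorem integral_fracDeriv_check {α k : ℝ} (hα : 0 < α) (hk : 0 < k) (v : ℕ → E)
    (m : ℕ) :
    ∫ t in ((m : ℝ) * k)..((m + 1 : ℕ) * k), fracDeriv α (check k v) t =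
      ∑ j ∈ Finset.range (m + 1), weight α k (m - j) • v (j + 1) -
      ∑ j ∈ Finset.range m, weight α k (m - 1 - j) • v (j + 1) := by
  have hle : (m : ℝ) * k ≤ (m + 1 : ℕ) * k := by push_cast; nlinarith
  set G : ℝ → E := fun t => ∑ j ∈ Finset.range m, ((t - j * k) ^ α / Real.Gamma (α + 1) -
      (t - (j + 1 : ℕ) * k) ^ α / Real.Gamma (α + 1)) • v (j + 1) +
      ((t - m * k) ^ α / Real.Gamma (α + 1)) • v (m + 1) with hG
  set G' : ℝ → E := fun t => ∑ j ∈ Finset.range m, (omega α (t - j * k) -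
      omega α (t - (j + 1 : ℕ) * k)) • v (j + 1) + omega α (t - m * k) • v (m + 1) with hG'
  have hd : ∀ t ∈ Set.Ioo ((m : ℝ) * k) ((m + 1 : ℕ) * k), HasDerivAt G (G' t) t := by
    intro t ht
    have h1 : ∀ j ≤ m, HasDerivAt (fun t : ℝ => (t - j * k) ^ α / Real.Gamma (α + 1))
        (omega α (t - j * k)) t := fun j hj => by
      have hpos : 0 < t - j * k := by
        have : (j : ℝ) * k ≤ m * k := by gcongr
        linarith [ht.1]
      exact (hasDerivAt_rpow_div_Gamma hα hpos).comp_sub_const t _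
    refine HasDerivAt.add (HasDerivAt.fun_sum fun j hj => ?_) ((h1 m le_rfl).smul_const _)
    have hj' := Finset.mem_range.1 hj
    exact ((h1 j hj'.le).sub (h1 (j + 1) hj')).smul_const _
  have hc : ContinuousOn G (Set.Icc ((m : ℝ) * k) ((m + 1 : ℕ) * k)) := by
    have h1 : ∀ c : ℝ, Continuous fun t : ℝ => (t - c) ^ α / Real.Gamma (α + 1) := fun c =>
      ((continuous_id.sub continuous_const).rpow_const fun _ => Or.inr hα.le).div_const _
    exact ((continuous_finsetSum _ fun j _ => ((h1 _).sub (h1 _)).smul continuous_const).add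
      ((h1 _).smul continuous_const)).continuousOn
  have hint : IntervalIntegrable G' volume (m * k) ((m + 1 : ℕ) * k) := by
    have h1 := fun c : ℝ => intervalIntegrable_omega_sub_right hα c (m * k) ((m + 1 : ℕ) * k)
    have h2 := IntervalIntegrable.sum (Finset.range m)
      (f := fun j t => (omega α (t - j * k) - omega α (t - (j + 1 : ℕ) * k)) • v (j + 1))
      (μ := volume) (a := m * k) (b := (m + 1 : ℕ) * k)
      fun j _ => intervalIntegrable_smul_const ((h1 _).sub (h1 _)) _
    have := h2.add (intervalIntegrable_smul_const (h1 (m * k)) (v (m + 1)))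
    exact this.congr fun t _ => by simp [hG']
  have hcongr : ∫ t in ((m : ℝ) * k)..((m + 1 : ℕ) * k), fracDeriv α (check k v) t =
      ∫ t in ((m : ℝ) * k)..((m + 1 : ℕ) * k), G' t := by
    rw [intervalIntegral.integral_of_le hle, intervalIntegral.integral_of_le hle,
      integral_Ioc_eq_integral_Ioo, integral_Ioc_eq_integral_Ioo]
    refine setIntegral_congr_fun measurableSet_Ioo fun t ht => ?_
    refine HasDerivAt.deriv ((hd t ht).congr_of_eventuallyEq ?_)
    filter_upwards [isOpen_Ioo.mem_nhds ht] with s hs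
    exact fracInt_check hα hk v hs.1.le hs.2.le
  rw [hcongr, intervalIntegral.integral_eq_sub_of_hasDerivAt_of_le hle hc hd hint, hG]
  have e1 : ∀ i j : ℕ, j ≤ i → ((i : ℝ) * k - j * k) = (i - j : ℕ) * k := fun i j h => by
    push_cast [h]; ring
  simp only
  rw [Finset.sum_range_succ, sub_self, Real.zero_rpow hα.ne', zero_div, zero_smul, add_zero]
  congr 1
  · congr 1
    · refine Finset.sum_congr rfl fun j hj => ?_
      have hj' := Finset.mem_range.1 hj
      rw [e1 _ _ (by omega), e1 _ _ (by omega), weight_eq hα,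
        show m + 1 - j = m - j + 1 by omega, Nat.add_sub_add_right]
    · rw [e1 _ _ (by omega), weight_eq hα]
      simp [Real.zero_rpow hα.ne']
  · refine Finset.sum_congr rfl fun j hj => ?_
    have hj' := Finset.mem_range.1 hj
    rw [e1 _ _ (by omega), e1 _ _ (by omega), weight_eq hα,
      show m - (j + 1) = m - 1 - j by omega, show m - 1 - j + 1 = m - j by omega]

end Interpolant

/-! ### Summation by parts and discrete convolutions. -/

/-- The shift `j ↦ j + 1` in the second sum pairs `v (j+1)` with `v j` under the same weight; only
`v 0` is left unpaired. It isolates the initial datum in the scheme. -/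
theorem sum_weight_smul_abel {E : Type*} [AddCommGroup E] [Module ℝ E] (w : ℕ → ℝ) (v : ℕ → E)
    (m : ℕ) :
    ∑ j ∈ Finset.range (m + 1), w (m - j) • v (j + 1) -
      ∑ j ∈ Finset.range m, w (m - 1 - j) • v (j + 1) =
    w m • v 0 + ∑ j ∈ Finset.range (m + 1), w (m - j) • (v (j + 1) - v j) := by
  have h : ∑ j ∈ Finset.range (m + 1), w (m - j) • v j =
      w m • v 0 + ∑ j ∈ Finset.range m, w (m - 1 - j) • v (j + 1) := by
    rw [Finset.sum_range_succ', add_comm]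
    congr 1
    exact Finset.sum_congr rfl fun j _ => by rw [show m - (j + 1) = m - 1 - j by omega]
  simp_rw [smul_sub]
  rw [Finset.sum_sub_distrib, h]
  abel

/-- A discrete convolution with a nonnegative, decreasing and convex sequence of weights is of
positive type. -/
theorem sum_inner_conv_nonneg {E : Type*} [NormedAddCommGroup E] [InnerProductSpace ℝ E]
    (w : ℕ → ℝ) (hw : ∀ m, 0 ≤ w m) (hw1 : ∀ m, w (m + 1) ≤ w m)
    (hw2 : ∀ m, w (m + 1) - w (m + 2) ≤ w m - w (m + 1)) (d : ℕ → E) (n : ℕ) :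
    0 ≤ ∑ m ∈ Finset.range n, inner ℝ (∑ j ∈ Finset.range (m + 1), w (m - j) • d j) (d m) := by
  -- `X` is the sequence of partial sums of `d`.
  obtain ⟨X, hX0, hXs⟩ : ∃ X : ℕ → E, X 0 = 0 ∧ ∀ n, X (n + 1) = X n + d n :=
    ⟨fun n => ∑ j ∈ Finset.range n, d j, by simp, fun n => Finset.sum_range_succ _ _⟩
  set b : ℕ → ℝ := fun m => w m - w (m + 1) with hb
  have hb0 : ∀ m, 0 ≤ b m := fun m => sub_nonneg.2 (hw1 m)
  have hin : ∀ x y : E, ‖x‖ ^ 2 - ‖y‖ ^ 2 ≤ 2 * inner ℝ x (x - y) := fun x y => by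
    have h1 := norm_sub_sq_real x y
    have h2 : inner ℝ x (x - y) = ‖x‖ ^ 2 - inner ℝ x y := by
      rw [inner_sub_right, real_inner_self_eq_norm_sq]
    nlinarith [sq_nonneg ‖x - y‖]
  -- The induction needs a stronger bound: the left side is an energy of the history of `X`,
  -- nonnegative because `w` is nonnegative and decreasing.
  suffices h : w n * ‖X n‖ ^ 2 + ∑ j ∈ Finset.range n, b (n - 1 - j) * ‖X n - X j‖ ^ 2 ≤
      2 * ∑ m ∈ Finset.range n, inner ℝ (∑ j ∈ Finset.range (m + 1), w (m - j) • d j) (d m) by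
    have h0 : 0 ≤ ∑ j ∈ Finset.range n, b (n - 1 - j) * ‖X n - X j‖ ^ 2 :=
      Finset.sum_nonneg fun j _ => mul_nonneg (hb0 _) (sq_nonneg _)
    have := mul_nonneg (hw n) (sq_nonneg ‖X n‖)
    linarith
  induction n with
  | zero => simp [hX0]
  | succ m ih =>
    rw [Finset.sum_range_succ (f := fun m => inner ℝ
      (∑ j ∈ Finset.range (m + 1), w (m - j) • d j) (d m)), mul_add]
    refine le_trans ?_ (add_le_add_left ih _)
    -- Summation by parts expresses the convolution through the history differences `X (m+1) - X j`,
    -- whose coefficients are the nonnegative `b`.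
    have hJ : ∑ j ∈ Finset.range (m + 1), w (m - j) • d j =
        w (m + 1) • X (m + 1) + ∑ j ∈ Finset.range (m + 1), b (m - j) • (X (m + 1) - X j) := by
      have hA := sum_weight_smul_abel w (fun j => X (m + 1) - X j) m
      have hd : ∀ j, X (m + 1) - X (j + 1) - (X (m + 1) - X j) = -d j := fun j => by
        rw [hXs j]; abel
      simp only [hd, hX0, sub_zero, smul_neg, Finset.sum_neg_distrib] at hA
      have hB : ∑ j ∈ Finset.range (m + 1), w (m + 1 - j) • (X (m + 1) - X j) =
          w (m + 1) • X (m + 1) + ∑ j ∈ Finset.range m, w (m - j) • (X (m + 1) - X (j + 1)) := by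
        rw [Finset.sum_range_succ', add_comm]
        simp [hX0]
      have hC : ∑ j ∈ Finset.range (m + 1), w (m - j) • (X (m + 1) - X (j + 1)) =
          ∑ j ∈ Finset.range m, w (m - j) • (X (m + 1) - X (j + 1)) := by
        rw [Finset.sum_range_succ]; simp
      have hD : ∑ j ∈ Finset.range (m + 1), w (m - j) • (X (m + 1) - X j) =
          w m • X (m + 1) + ∑ j ∈ Finset.range m, w (m - 1 - j) • (X (m + 1) - X (j + 1)) := by
        rw [Finset.sum_range_succ', add_comm, hX0, sub_zero, Nat.sub_zero]
        congr 1
        exact Finset.sum_congr rfl fun j _ => by rw [show m - (j + 1) = m - 1 - j by omega]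
      have hE : ∑ j ∈ Finset.range (m + 1), b (m - j) • (X (m + 1) - X j) =
          ∑ j ∈ Finset.range (m + 1), w (m - j) • (X (m + 1) - X j) -
          ∑ j ∈ Finset.range (m + 1), w (m + 1 - j) • (X (m + 1) - X j) := by
        rw [← Finset.sum_sub_distrib]
        refine Finset.sum_congr rfl fun j hj => ?_
        have hj' := Finset.mem_range.1 hj
        rw [← sub_smul, hb]
        simp only
        rw [show m + 1 - j = m - j + 1 by omega]
      have hF := congrArg (fun x => w m • X (m + 1) - x) hA
      simp only [sub_add_cancel_left, neg_neg] at hF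
      rw [hE, hD, hB, ← hC, ← hF]
      abel
    rw [hJ, inner_add_left, real_inner_smul_left, sum_inner, mul_add, Finset.mul_sum]
    simp only [real_inner_smul_left]
    have h1 : w (m + 1) * ‖X (m + 1)‖ ^ 2 ≤
        w m * ‖X m‖ ^ 2 + 2 * (w (m + 1) * inner ℝ (X (m + 1)) (d m)) := by
      have h := hin (X (m + 1)) (X m)
      rw [hXs m, add_sub_cancel_left, ← hXs m] at h
      nlinarith [hw (m + 1), mul_le_mul_of_nonneg_right (hw1 m) (sq_nonneg ‖X m‖)]
    have h2 : ∑ j ∈ Finset.range (m + 1), b (m + 1 - 1 - j) * ‖X (m + 1) - X j‖ ^ 2 ≤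
        ∑ j ∈ Finset.range m, b (m - 1 - j) * ‖X m - X j‖ ^ 2 +
        ∑ j ∈ Finset.range (m + 1), 2 * (b (m - j) * inner ℝ (X (m + 1) - X j) (d m)) := by
      -- Convexity of `w` enters here: `b` is decreasing, so ageing the history by one step lowers
      -- its energy.
      have h3 : ∑ j ∈ Finset.range m, b (m - j) * ‖X m - X j‖ ^ 2 ≤
          ∑ j ∈ Finset.range m, b (m - 1 - j) * ‖X m - X j‖ ^ 2 := by
        refine Finset.sum_le_sum fun j hj => mul_le_mul_of_nonneg_right ?_ (sq_nonneg _)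
        have hj' := Finset.mem_range.1 hj
        have := hw2 (m - 1 - j)
        rw [show m - 1 - j + 2 = m - j + 1 by omega, show m - 1 - j + 1 = m - j by omega] at this
        simp only [hb]
        rwa [show m - 1 - j + 1 = m - j by omega]
      have h4 : ∑ j ∈ Finset.range (m + 1), b (m - j) * ‖X m - X j‖ ^ 2 =
          ∑ j ∈ Finset.range m, b (m - j) * ‖X m - X j‖ ^ 2 := by
        rw [Finset.sum_range_succ]; simp
      rw [← h4] at h3
      refine le_trans ?_ (add_le_add_left h3 _)
      rw [← Finset.sum_add_distrib]
      refine Finset.sum_le_sum fun j _ => ?_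
      have h := hin (X (m + 1) - X j) (X m - X j)
      rw [show X (m + 1) - X j - (X m - X j) = d m by rw [hXs]; abel] at h
      rw [Nat.add_sub_cancel]
      nlinarith [mul_le_mul_of_nonneg_left h (hb0 (m - j))]
    linarith

/-- Discrete integration commutes with convolution. The partial sums on the right are the unknown in
Gronwall's inequality. -/
theorem sum_conv_eq_conv_sum (w a : ℕ → ℝ) (n : ℕ) :
    ∑ m ∈ Finset.range n, ∑ j ∈ Finset.range (m + 1), w (m - j) * a j =
      ∑ m ∈ Finset.range n, w (n - 1 - m) * ∑ j ∈ Finset.range (m + 1), a j := by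
  induction n with
  | zero => simp
  | succ n ih =>
    rw [Finset.sum_range_succ, ih]
    have h := sum_weight_smul_abel w (fun j => ∑ i ∈ Finset.range j, a i) n
    simp only [smul_eq_mul, Finset.sum_range_zero, mul_zero, zero_add, Finset.sum_range_succ,
      add_sub_cancel_left] at h ⊢
    rw [Nat.add_sub_cancel]
    linarith

theorem norm_conv_sq_le {E : Type*} [NormedAddCommGroup E] [NormedSpace ℝ E]
    (w : ℕ → ℝ) (hw : ∀ m, 0 ≤ w m) (d : ℕ → E) (m : ℕ) :
    ‖∑ j ∈ Finset.range (m + 1), w (m - j) • d j‖ ^ 2 ≤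
      (∑ i ∈ Finset.range (m + 1), w i) * ∑ j ∈ Finset.range (m + 1), w (m - j) * ‖d j‖ ^ 2 := by
  have h1 : ‖∑ j ∈ Finset.range (m + 1), w (m - j) • d j‖ ≤
      ∑ j ∈ Finset.range (m + 1), w (m - j) * ‖d j‖ :=
    (norm_sum_le _ _).trans (le_of_eq (Finset.sum_congr rfl fun j _ => by
      rw [norm_smul, Real.norm_of_nonneg (hw _)]))
  have h2 : ∑ i ∈ Finset.range (m + 1), w i = ∑ j ∈ Finset.range (m + 1), w (m - j) := by
    rw [← Finset.sum_range_reflect]; simp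
  rw [h2]
  refine (pow_le_pow_left₀ (norm_nonneg _) h1 2).trans ?_
  refine Finset.sum_sq_le_sum_mul_sum_of_sq_le_mul _ (fun j _ => hw _)
    (fun j _ => mul_nonneg (hw _) (sq_nonneg _)) fun j _ => le_of_eq (by ring)

theorem sum_norm_conv_sq_le {E : Type*} [NormedAddCommGroup E] [NormedSpace ℝ E]
    (w : ℕ → ℝ) (hw : ∀ m, 0 ≤ w m) (d : ℕ → E) (n : ℕ) :
    ∑ m ∈ Finset.range n, ‖∑ j ∈ Finset.range (m + 1), w (m - j) • d j‖ ^ 2 ≤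
      (∑ i ∈ Finset.range n, w i) * ∑ m ∈ Finset.range n, w (n - 1 - m) *
        ∑ j ∈ Finset.range (m + 1), ‖d j‖ ^ 2 := by
  rw [← sum_conv_eq_conv_sum, Finset.mul_sum]
  refine Finset.sum_le_sum fun m hm => (norm_conv_sq_le w hw d m).trans ?_
  refine mul_le_mul_of_nonneg_right ?_
    (Finset.sum_nonneg fun j _ => mul_nonneg (hw _) (sq_nonneg _))
  exact Finset.sum_le_sum_of_subset_of_nonneg
    (Finset.range_mono (Finset.mem_range.1 hm)) fun i _ _ => hw i

/-! ### The Mittag-Leffler function -/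

/-- This is Euler's beta integral, transferred from its complex version. It says that `I^α` sends
each term of the Mittag-Leffler series to the next. -/
theorem integral_omega_mul_rpow {α q t : ℝ} (hα : 0 < α) (hq : 0 ≤ q) (ht : 0 < t) :
    ∫ s in (0 : ℝ)..t, omega α (t - s) * s ^ q =
      Real.Gamma (q + 1) / Real.Gamma (q + 1 + α) * t ^ (q + α) := by
  have h1 : ∫ s in (0 : ℝ)..t, s ^ q * (t - s) ^ (α - 1) =
      t ^ (q + α) * ProbabilityTheory.beta (q + 1) α := by
    have hc := Complex.betaIntegral_scaled ((q + 1 : ℝ) : ℂ) (α : ℂ) ht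
    have hG := Complex.Gamma_mul_Gamma_eq_betaIntegral (s := ((q + 1 : ℝ) : ℂ)) (t := (α : ℂ))
      (by simp; linarith) (by simpa)
    have hb : Complex.betaIntegral ((q + 1 : ℝ) : ℂ) (α : ℂ) =
        (ProbabilityTheory.beta (q + 1) α : ℝ) := by
      rw [ProbabilityTheory.beta]
      push_cast
      rw [← Complex.Gamma_ofReal, ← Complex.Gamma_ofReal, ← Complex.Gamma_ofReal, eq_div_iff,
        mul_comm]
      · rw [← Complex.ofReal_add] at hG
        simpa using hG.symm
      · rw [Complex.Gamma_ofReal]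
        exact_mod_cast (Real.Gamma_pos_of_pos (by linarith)).ne'
    rw [hb] at hc
    apply Complex.ofReal_injective
    rw [← intervalIntegral.integral_ofReal, Complex.ofReal_mul, Complex.ofReal_cpow ht.le]
    have e : ((q + α : ℝ) : ℂ) = ((q + 1 : ℝ) : ℂ) + (α : ℂ) - 1 := by push_cast; ring
    rw [e, ← hc]
    refine intervalIntegral.integral_congr fun s hs => ?_
    rw [Set.uIcc_of_le ht.le] at hs
    rw [Complex.ofReal_mul, Complex.ofReal_cpow hs.1, Complex.ofReal_cpow (by linarith [hs.2])]
    push_cast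
    ring_nf
  have hΓ := (Real.Gamma_pos_of_pos hα).ne'
  have e2 : ∀ s : ℝ, omega α (t - s) * s ^ q =
      s ^ q * (t - s) ^ (α - 1) * (Real.Gamma α)⁻¹ := fun s => by unfold omega; ring
  simp_rw [e2]
  rw [intervalIntegral.integral_mul_const, h1, ProbabilityTheory.beta]
  field_simp

/-- `s^q` is increasing, so its value at the left end of each cell underestimates it there. -/
theorem sum_weight_mul_rpow_le {α k q : ℝ} (hα : 0 < α) (hk : 0 < k) (hq : 0 ≤ q)
    (m : ℕ) :
    ∑ i ∈ Finset.range (m + 1), weight α k (m - i) * ((i : ℝ) * k) ^ q ≤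
      Real.Gamma (q + 1) / Real.Gamma (q + 1 + α) * (((m + 1 : ℕ) : ℝ) * k) ^ (q + α) := by
  set t := ((m + 1 : ℕ) : ℝ) * k with ht
  have ht0 : 0 < t := by positivity
  rw [← integral_omega_mul_rpow hα hq ht0]
  have hint : ∀ a b : ℝ, IntervalIntegrable (fun s => omega α (t - s) * s ^ q) volume a b :=
    fun a b => (intervalIntegrable_omega_sub_left hα t a b).mul_continuousOn
      (Real.continuous_rpow_const hq).continuousOn
  have h4 := intervalIntegral.sum_integral_adjacent_intervals (a := fun j : ℕ => (j : ℝ) * k)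
    (n := m + 1) fun j _ => hint _ _
  simp only [Nat.cast_zero, zero_mul] at h4
  rw [← h4]
  refine Finset.sum_le_sum fun i hi => ?_
  have hi' := Finset.mem_range.1 hi
  have hle : (i : ℝ) * k ≤ (i + 1 : ℕ) * k := by push_cast; nlinarith
  have e : weight α k (m - i) = ∫ s in ((i : ℝ) * k)..((i + 1 : ℕ) * k), omega α (t - s) := by
    rw [intervalIntegral.integral_comp_sub_left (fun s => omega α s), weight, ht]
    have : i ≤ m := by omega
    congr 1 <;> push_cast [this] <;> ring
  rw [e, ← intervalIntegral.integral_mul_const]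
  refine intervalIntegral.integral_mono_on hle
    ((intervalIntegrable_omega_sub_left hα t _ _).mul_const _) (hint _ _) fun s hs => ?_
  have : s ≤ t := hs.2.trans (by rw [ht]; gcongr; omega)
  exact mul_le_mul_of_nonneg_left (Real.rpow_le_rpow (by positivity) hs.1 hq)
    (omega_nonneg hα (by linarith))

/-- Since `2α ≥ 1`, `Γ(1 + (2n + r)α) ≥ n!`, so the even and odd terms are each dominated by the
exponential series of `z²`. The case `n = 0` is left out because `Γ` increases only from `2` on. -/
theorem summable_mittagLeffler {α : ℝ} (hα : 1 / 2 < α) {z : ℝ} (hz : 0 ≤ z) :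
    Summable fun n : ℕ => z ^ n / Real.Gamma (1 + n * α) := by
  have hfac : ∀ n : ℕ, 1 ≤ n → ∀ x : ℝ, (n : ℝ) ≤ x → (n.factorial : ℝ) ≤ Real.Gamma (1 + x) := by
    intro n hn x hx
    rw [← Real.Gamma_nat_eq_factorial, add_comm]
    have : (1 : ℝ) ≤ n := by exact_mod_cast hn
    exact Real.Gamma_strictMonoOn_Ici.monotoneOn (by simp; linarith) (by simp; linarith)
      (by linarith)
  have hpos : ∀ n : ℕ, 0 < Real.Gamma (1 + n * α) := fun n =>
    Real.Gamma_pos_of_pos (by positivity)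
  set f : ℕ → ℝ := fun n => z ^ n / Real.Gamma (1 + n * α) with hf
  set g : ℕ → ℝ := fun n => (z ^ 2) ^ n / (n.factorial : ℝ) with hg
  have hsum : Summable g := Real.summable_pow_div_factorial _
  have hf0 : ∀ n, 0 ≤ f n := fun n => div_nonneg (pow_nonneg hz _) (hpos n).le
  have hle : ∀ n, 1 ≤ n → ∀ r : ℕ, f (2 * n + r) ≤ z ^ r * g n := fun n hn r => by
    simp only [hf, hg]
    rw [pow_add, pow_mul, mul_comm _ (z ^ r), mul_div_assoc]
    refine mul_le_mul_of_nonneg_left (div_le_div_of_nonneg_left (by positivity) (by positivity)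
      (hfac n hn _ ?_)) (by positivity)
    push_cast
    nlinarith [(Nat.cast_nonneg n : (0 : ℝ) ≤ n), (Nat.cast_nonneg r : (0 : ℝ) ≤ r)]
  have hpart : ∀ r : ℕ, Summable fun n => f (2 * n + r) := fun r => by
    have h1 : Summable fun n => z ^ r * g (n + 1) :=
      ((summable_nat_add_iff 1).2 hsum).mul_left _
    exact (summable_nat_add_iff 1).1 (Summable.of_nonneg_of_le
      (f := fun n => z ^ r * g (n + 1)) (g := fun n => f (2 * (n + 1) + r))
      (fun n => hf0 _) (fun n => hle (n + 1) (by omega) r) h1)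
  exact (HasSum.even_add_odd (f := f) (hpart 0).hasSum (hpart 1).hasSum).summable

theorem mittagLeffler_mono {α : ℝ} (hα : 1 / 2 < α) {y z : ℝ} (hy : 0 ≤ y) (hyz : y ≤ z) :
    mittagLeffler α y ≤ mittagLeffler α z :=
  (summable_mittagLeffler hα hy).tsum_le_tsum (fun n =>
    div_le_div_of_nonneg_right (pow_le_pow_left₀ hy hyz n)
      (Real.Gamma_pos_of_pos (by positivity)).le) (summable_mittagLeffler hα (hy.trans hyz))

theorem mittagLeffler_nonneg {α : ℝ} (hα : 0 < α) {z : ℝ} (hz : 0 ≤ z) : 0 ≤ mittagLeffler α z :=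
  tsum_nonneg fun n => div_nonneg (pow_nonneg hz n) (Real.Gamma_pos_of_pos (by positivity)).le

/-- The discrete counterpart of `1 + c I^α E_α(c t^α) ≤ E_α(c t^α)`. -/
theorem one_add_sum_weight_mul_mittagLeffler_le {α k c : ℝ} (hα : 1 / 2 < α)
    (hk : 0 < k) (hc : 0 ≤ c) (m : ℕ) :
    1 + c * ∑ i ∈ Finset.range (m + 1), weight α k (m - i) * mittagLeffler α (c * (i * k) ^ α) ≤
      mittagLeffler α (c * ((m + 1 : ℕ) * k) ^ α) := by
  have hα0 : 0 < α := by linarith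
  have hS : ∀ i : ℕ, Summable fun p : ℕ => (c * (i * k) ^ α) ^ p / Real.Gamma (1 + p * α) :=
    fun i => summable_mittagLeffler hα (by positivity)
  have hlast := (summable_nat_add_iff 1).2 (hS (m + 1))
  have e : mittagLeffler α (c * ((m + 1 : ℕ) * k) ^ α) = 1 + ∑' p : ℕ,
      (c * (((m + 1 : ℕ) : ℝ) * k) ^ α) ^ (p + 1) / Real.Gamma (1 + ((p + 1 : ℕ) : ℝ) * α) := by
    rw [mittagLeffler, (hS (m + 1)).tsum_eq_zero_add]
    simp
  rw [e]
  gcongr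
  have e2 : c * ∑ i ∈ Finset.range (m + 1), weight α k (m - i) * mittagLeffler α (c * (i * k) ^ α)
      = ∑' p : ℕ, ∑ i ∈ Finset.range (m + 1), c * (weight α k (m - i) *
        ((c * (i * k) ^ α) ^ p / Real.Gamma (1 + p * α))) := by
    rw [Summable.tsum_finsetSum fun i _ => ((hS i).mul_left _).mul_left _, Finset.mul_sum]
    refine Finset.sum_congr rfl fun i _ => ?_
    rw [tsum_mul_left, tsum_mul_left, mittagLeffler]
  rw [e2]
  refine Summable.tsum_le_tsum (fun p => ?_)
    (summable_sum fun i _ => ((hS i).mul_left _).mul_left _) hlast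
  have hq : (0 : ℝ) ≤ p * α := by positivity
  have hΓ := Real.Gamma_pos_of_pos (show 0 < 1 + (p : ℝ) * α by positivity)
  have h := sum_weight_mul_rpow_le hα0 hk hq m
  have e3 : ∀ i : ℕ, (((i : ℝ) * k) ^ α) ^ p = ((i : ℝ) * k) ^ (p * α) := fun i => by
    rw [← Real.rpow_natCast, ← Real.rpow_mul (by positivity), mul_comm α]
  calc ∑ i ∈ Finset.range (m + 1), c * (weight α k (m - i) *
        ((c * (i * k) ^ α) ^ p / Real.Gamma (1 + p * α)))
      = c ^ (p + 1) / Real.Gamma (1 + p * α) *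
        ∑ i ∈ Finset.range (m + 1), weight α k (m - i) * ((i : ℝ) * k) ^ (p * α) := by
        rw [Finset.mul_sum]
        refine Finset.sum_congr rfl fun i _ => ?_
        rw [mul_pow, e3]; ring
    _ ≤ c ^ (p + 1) / Real.Gamma (1 + p * α) * (Real.Gamma (p * α + 1) /
        Real.Gamma (p * α + 1 + α) * (((m + 1 : ℕ) : ℝ) * k) ^ (p * α + α)) := by gcongr
    _ = _ := by
        rw [mul_pow, ← Real.rpow_natCast (_ ^ α), ← Real.rpow_mul (by positivity),
          add_comm (p * α) 1, show (1 : ℝ) + p * α + α = 1 + ((p + 1 : ℕ) : ℝ) * α by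
            push_cast; ring, show (p : ℝ) * α + α = α * ((p + 1 : ℕ) : ℝ) by push_cast; ring]
        field_simp

/-- A discrete fractional Gronwall inequality. -/
theorem fractional_gronwall {α k B c : ℝ} (hα : 1 / 2 < α) (hα1 : α ≤ 1) (hk : 0 < k)
    (hB : 0 ≤ B) (hc : 0 ≤ c) (hck : c * weight α k 0 ≤ 1 / 2) (s : ℕ → ℝ) (n : ℕ)
    (hs0 : ∀ m < n, 0 ≤ s m)
    (hs : ∀ m < n, s m ≤ B + c * ∑ j ∈ Finset.range (m + 1), weight α k (m - j) * s j) :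
    ∀ m < n, s m ≤ 2 * B * mittagLeffler α (2 * c * ((m + 1 : ℕ) * k) ^ α) := by
  have hα0 : 0 < α := by linarith
  intro m
  induction m using Nat.strong_induction_on with
  | _ m ih =>
    intro hm
    set f : ℕ → ℝ := fun i => mittagLeffler α (2 * c * (i * k) ^ α) with hf
    have hf0 : ∀ i, 0 ≤ f i := fun i => mittagLeffler_nonneg hα0 (by positivity)
    have hw := weight_nonneg (k := k) hα0 hk.le
    have h1 := hs m hm
    rw [Finset.sum_range_succ, Nat.sub_self] at h1
    have h2 : ∑ j ∈ Finset.range m, weight α k (m - j) * s j ≤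
        2 * B * ∑ i ∈ Finset.range (m + 1), weight α k (m - i) * f i := by
      rw [Finset.sum_range_succ', mul_add, Finset.mul_sum]
      refine le_add_of_le_of_nonneg (Finset.sum_le_sum fun j hj => ?_) ?_
      · have hj' := Finset.mem_range.1 hj
        have h3 := ih j hj' (hj'.trans hm)
        -- The induction bounds `s j` by `f (j+1)`, one node later; monotone weights allow the
        -- matching shift, and the sum takes the left-endpoint form of the Mittag-Leffler
        -- inequality.
        have h4 : weight α k (m - j) ≤ weight α k (m - (j + 1)) := by
          rw [show m - j = m - (j + 1) + 1 by omega]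
          exact weight_succ_le hα0 hα1 hk.le _
        calc weight α k (m - j) * s j ≤ weight α k (m - (j + 1)) * (2 * B * f (j + 1)) :=
              mul_le_mul h4 h3 (hs0 j (hj'.trans hm)) (hw _)
          _ = _ := by ring
      · exact mul_nonneg (by positivity) (mul_nonneg (hw _) (hf0 _))
    have h5 := one_add_sum_weight_mul_mittagLeffler_le hα hk (c := 2 * c) (by positivity) m
    have h6 := mul_le_mul_of_nonneg_left h2 hc
    have h7 := mul_le_mul_of_nonneg_right hck (hs0 m hm)
    have h8 := mul_le_mul_of_nonneg_left h5 (show 0 ≤ 2 * B by positivity)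
    -- The diagonal term `c * weight α k 0 * s m` is at most `s m / 2`; absorbing it doubles both
    -- `B` and `c`.
    nlinarith

/-! ### Test functions, weak derivatives and `H¹₀(Ω)`. -/

variable {L : ℝ}

namespace IsTest
variable {φ ψ : ℝ → ℝ}

theorem memLp (h : IsTest L φ) : MemLp φ 2 (μ L) :=
  (h.1.continuous.memLp_of_hasCompactSupport h.2.1).restrict _

theorem differentiable (h : IsTest L φ) : Differentiable ℝ φ :=
  h.1.differentiable (by simp)

theorem deriv (h : IsTest L φ) : IsTest L (deriv φ) :=
  ⟨(contDiff_infty_iff_deriv.1 h.1).2, h.2.1.deriv,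
    (closure_minimal (support_deriv_subset) (isClosed_tsupport φ)).trans h.2.2⟩

theorem add (h : IsTest L φ) (h' : IsTest L ψ) : IsTest L (φ + ψ) :=
  ⟨h.1.add h'.1, h.2.1.add h'.2.1,
    (tsupport_add φ ψ).trans (Set.union_subset h.2.2 h'.2.2)⟩

theorem const_smul (h : IsTest L φ) (c : ℝ) : IsTest L (c • φ) :=
  ⟨h.1.const_smul c, h.2.1.smul_left (f := fun _ => c),
    (closure_mono (Function.support_const_smul_subset c φ)).trans h.2.2⟩

theorem mul (h : IsTest L φ) (h' : IsTest L ψ) : IsTest L (φ * ψ) :=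
  ⟨h.1.mul h'.1, h.2.1.mul_right, tsupport_mul_subset_left.trans h.2.2⟩

/-- A test function as an element of `L₂(Ω)`. -/
def toL2 (h : IsTest L φ) : L2 L := h.memLp.toLp φ

theorem coeFn_toL2 (h : IsTest L φ) : h.toL2 =ᵐ[μ L] φ := h.memLp.coeFn_toLp

end IsTest

theorem inner_eq_integral (u v : L2 L) : inner ℝ u v = ∫ x, u x * v x ∂(μ L) := by
  rw [L2.inner_def]
  refine integral_congr_ae (Eventually.of_forall fun x => ?_)
  simp [mul_comm]

theorem norm_sq_eq_integral (u : L2 L) : ‖u‖ ^ 2 = ∫ x, u x ^ 2 ∂(μ L) := by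
  rw [← real_inner_self_eq_norm_sq, inner_eq_integral]
  simp_rw [sq]

theorem norm_sq_le_of_ae {z a b c : L2 L} {C : ℝ}
    (h : ∀ᵐ x ∂(μ L), z x ^ 2 ≤ C * (a x ^ 2 + b x ^ 2 + c x ^ 2)) :
    ‖z‖ ^ 2 ≤ C * (‖a‖ ^ 2 + ‖b‖ ^ 2 + ‖c‖ ^ 2) := by
  have hi : ∀ u : L2 L, Integrable (fun x => u x ^ 2) (μ L) := fun u => (Lp.memLp u).integrable_sq
  simp_rw [norm_sq_eq_integral]
  rw [← integral_add (hi a) (hi b), ← integral_add (f := fun x => a x ^ 2 + b x ^ 2)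
    ((hi a).add (hi b)) (hi c),
    ← integral_const_mul]
  exact integral_mono_ae (hi z) ((((hi a).add (hi b)).add (hi c)).const_mul C) h

theorem L2_locallyIntegrableOn (u : L2 L) : LocallyIntegrableOn u (Set.Ioo 0 L) := by
  have h : IntegrableOn u (Set.Ioo 0 L) := (Lp.memLp u).integrable (by norm_num)
  exact h.locallyIntegrableOn

theorem hasWeakDeriv_iff (u v : L2 L) :
    HasWeakDeriv L u v ↔ ∀ φ (h : IsTest L φ), inner ℝ u h.deriv.toL2 = -inner ℝ v h.toL2 := by
  have e : ∀ (w : L2 L) (φ : ℝ → ℝ) (h : IsTest L φ),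
      inner ℝ w h.toL2 = ∫ x in Set.Ioo 0 L, w x * φ x := fun w φ h => by
    rw [inner_eq_integral]
    refine integral_congr_ae ?_
    filter_upwards [h.coeFn_toL2] with x hx
    rw [hx]
  refine ⟨fun H φ h => ?_, fun H => ⟨L2_locallyIntegrableOn u, L2_locallyIntegrableOn v,
    fun φ h => ?_⟩⟩
  · rw [e, e]; exact H.2.2 φ h
  · rw [← e u _ h.deriv, ← e v _ h]; exact H φ h

/-- Stated by convergence in `L2 L`, membership passes through linear combinations and limits of
inner products. -/
theorem memH10_iff (u ux : L2 L) :
    MemH10 L u ux ↔ HasWeakDeriv L u ux ∧ ∃ φ : ℕ → ℝ → ℝ, ∃ h : ∀ m, IsTest L (φ m),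
      Tendsto (fun m => (h m).toL2) atTop (𝓝 u) ∧
      Tendsto (fun m => (h m).deriv.toL2) atTop (𝓝 ux) := by
  have e : ∀ (w : L2 L) (φ : ℕ → ℝ → ℝ) (h : ∀ m, IsTest L (φ m)),
      Tendsto (fun m => (h m).toL2) atTop (𝓝 w) ↔
      Tendsto (fun m => eLpNorm (fun x => w x - φ m x) 2 (μ L)) atTop (𝓝 0) := fun w φ h => by
    rw [Lp.tendsto_Lp_iff_tendsto_eLpNorm']
    refine tendsto_congr fun m => ?_
    rw [eLpNorm_sub_comm]
    refine eLpNorm_congr_ae ?_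
    filter_upwards [(h m).coeFn_toL2] with x hx
    simp [hx]
  refine and_congr_right fun _ => exists_congr fun φ => ⟨fun ⟨h, h1, h2⟩ => ⟨h, ?_, ?_⟩,
    fun ⟨h, h1, h2⟩ => ⟨h, ?_, ?_⟩⟩
  · exact (e u φ h).2 h1
  · exact (e ux _ fun m => (h m).deriv).2 h2
  · exact (e u φ h).1 h1
  · exact (e ux _ fun m => (h m).deriv).1 h2

namespace MemH10
variable {u ux v vx : L2 L}

theorem zero : MemH10 L 0 0 := by
  have h0 : IsTest L 0 :=
    ⟨contDiff_const, HasCompactSupport.zero, by simp [tsupport]⟩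
  have e : ∀ {φ : ℝ → ℝ} (h : IsTest L φ), (∀ x, φ x = 0) → h.toL2 = 0 := fun h h' =>
    (Lp.eq_zero_iff_ae_eq_zero).2 (h.coeFn_toL2.trans (Eventually.of_forall h'))
  refine (memH10_iff _ _).2 ⟨(hasWeakDeriv_iff _ _).2 fun φ h => by simp, fun _ => 0,
    fun _ => h0, ?_, ?_⟩
  · simp [e h0 fun _ => rfl]
  · exact tendsto_const_nhds.congr fun _ => (e h0.deriv fun x => by simp).symm

theorem add (hu : MemH10 L u ux) (hv : MemH10 L v vx) : MemH10 L (u + v) (ux + vx) := by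
  rw [memH10_iff, hasWeakDeriv_iff] at *
  obtain ⟨hu, φ, hφ, h1, h2⟩ := hu
  obtain ⟨hv, ψ, hψ, h3, h4⟩ := hv
  refine ⟨fun χ h => ?_, fun m => φ m + ψ m, fun m => (hφ m).add (hψ m), ?_, ?_⟩
  · rw [inner_add_left, inner_add_left, hu χ h, hv χ h]; ring
  · refine (h1.add h3).congr fun m => ?_
    exact (MemLp.toLp_add _ _).symm
  · refine (h2.add h4).congr fun m => ?_
    rw [IsTest.toL2, IsTest.toL2, ← MemLp.toLp_add]
    refine MemLp.toLp_congr _ _ (Eventually.of_forall fun x => ?_)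
    exact (deriv_add ((hφ m).differentiable x) ((hψ m).differentiable x)).symm

theorem const_smul (hu : MemH10 L u ux) (c : ℝ) : MemH10 L (c • u) (c • ux) := by
  rw [memH10_iff, hasWeakDeriv_iff] at *
  obtain ⟨hu, φ, hφ, h1, h2⟩ := hu
  refine ⟨fun χ h => ?_, fun m => c • φ m, fun m => (hφ m).const_smul c, ?_, ?_⟩
  · rw [real_inner_smul_left, real_inner_smul_left, hu χ h]; ring
  · refine (h1.const_smul c).congr fun m => ?_
    exact (MemLp.toLp_const_smul _ _).symm
  · refine (h2.const_smul c).congr fun m => ?_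
    rw [IsTest.toL2, ← MemLp.toLp_const_smul]
    refine MemLp.toLp_congr _ _ (Eventually.of_forall fun x => ?_)
    exact (deriv_const_smul c ((hφ m).differentiable x)).symm

theorem sub (hu : MemH10 L u ux) (hv : MemH10 L v vx) : MemH10 L (u - v) (ux - vx) := by
  simpa [sub_eq_add_neg] using hu.add (hv.const_smul (-1))

theorem sum {ι : Type*} (s : Finset ι) {f fx : ι → L2 L} (h : ∀ i ∈ s, MemH10 L (f i) (fx i)) :
    MemH10 L (∑ i ∈ s, f i) (∑ i ∈ s, fx i) := by
  classical
  induction s using Finset.induction_on with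
  | empty => simpa using zero
  | insert a s ha ih =>
    rw [Finset.sum_insert ha, Finset.sum_insert ha]
    exact (h a (by simp)).add (ih fun i hi => h i (by simp [hi]))

/-- Integration by parts against an element of `H¹₀(Ω)`. -/
theorem inner_deriv_eq_neg (hv : MemH10 L v vx) {w wx : L2 L} (hw : HasWeakDeriv L w wx) :
    inner ℝ w vx = -inner ℝ wx v := by
  rw [hasWeakDeriv_iff] at hw
  obtain ⟨-, ψ, hψ, h3, h4⟩ := (memH10_iff _ _).1 hv
  refine tendsto_nhds_unique (tendsto_const_nhds.inner h4) ?_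
  simp_rw [fun m => hw _ (hψ m)]
  exact (tendsto_const_nhds.inner h3).neg

end MemH10

/-! ### Bounded coefficients and the product rule. -/

/-- Multiplication by a bounded function, as an operator on `L₂(Ω)`. -/
def mulL2 {f : ℝ → ℝ} (hf : MemLp f ∞ (μ L)) : L2 L →L[ℝ] L2 L :=
  (ContinuousLinearMap.mul ℝ ℝ).holderL (μ L) ∞ 2 2 (hf.toLp f)

theorem coeFn_mulL2 {f : ℝ → ℝ} (hf : MemLp f ∞ (μ L)) (u : L2 L) :
    mulL2 hf u =ᵐ[μ L] fun x => f x * u x := by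
  have h := (ContinuousLinearMap.mul ℝ ℝ).coeFn_holder (r := 2) (hf.toLp f) u
  filter_upwards [h, hf.coeFn_toLp] with x h1 h2
  rw [← h2]
  exact h1

theorem inner_mulL2 {f : ℝ → ℝ} (hf : MemLp f ∞ (μ L)) (u v : L2 L) :
    inner ℝ (mulL2 hf u) v = ∫ x in Set.Ioo 0 L, f x * u x * v x := by
  rw [inner_eq_integral]
  refine integral_congr_ae ?_
  filter_upwards [coeFn_mulL2 hf u] with x hx
  rw [hx]

/-- The product rule for a bounded coefficient with bounded weak derivative, integrated by parts
against an element of `H¹₀(Ω)`. -/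
theorem inner_mulL2_deriv_eq_neg {f fx : ℝ → ℝ} (hf : MemLp f ∞ (μ L)) (hfx : MemLp fx ∞ (μ L))
    (hw : HasWeakDeriv L f fx) {u ux v vx : L2 L} (hu : MemH10 L u ux) (hv : MemH10 L v vx) :
    inner ℝ (mulL2 hf u) vx = -inner ℝ (mulL2 hfx u + mulL2 hf ux) v := by
  -- For two test functions, `φ * ψ` is an admissible test function for the weak derivative of `f`;
  -- density and continuity of `mulL2` give the general case.
  have htest : ∀ φ ψ (hφ : IsTest L φ) (hψ : IsTest L ψ), inner ℝ (mulL2 hf hφ.toL2) hψ.deriv.toL2 =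
      -inner ℝ (mulL2 hfx hφ.toL2 + mulL2 hf hφ.deriv.toL2) hψ.toL2 := by
    intro φ ψ hφ hψ
    have e : ∀ {g a b : ℝ → ℝ} (hg : MemLp g ∞ (μ L)) (ha : IsTest L a) (hb : IsTest L b),
        inner ℝ (mulL2 hg ha.toL2) hb.toL2 = ∫ x in Set.Ioo 0 L, g x * (a x * b x) ∧
        Integrable (fun x => g x * (a x * b x)) (μ L) := fun {g a b} hg ha hb => by
      have hae : (fun x => mulL2 hg ha.toL2 x * hb.toL2 x) =ᵐ[μ L] fun x => g x * (a x * b x) := by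
        filter_upwards [coeFn_mulL2 hg ha.toL2, ha.coeFn_toL2, hb.coeFn_toL2] with x h1 h2 h3
        rw [h1, h2, h3, mul_assoc]
      refine ⟨by rw [inner_eq_integral]; exact integral_congr_ae hae, Integrable.congr ?_ hae⟩
      exact (Lp.memLp (mulL2 hg ha.toL2)).integrable_mul (Lp.memLp hb.toL2)
    have h := hw.2.2 _ (hφ.mul hψ)
    have hd : ∀ x, f x * deriv (φ * ψ) x = f x * (deriv φ x * ψ x) + f x * (φ x * deriv ψ x) :=
      fun x => by
        rw [deriv_mul (hφ.differentiable x) (hψ.differentiable x)]; ring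
    simp_rw [hd, Pi.mul_apply] at h
    rw [integral_add (e hf hφ.deriv hψ).2 (e hf hφ hψ.deriv).2, ← (e hf hφ.deriv hψ).1,
      ← (e hf hφ hψ.deriv).1, ← (e hfx hφ hψ).1] at h
    rw [inner_add_left]
    linarith
  obtain ⟨-, φ, hφ, h1, h2⟩ := (memH10_iff _ _).1 hu
  obtain ⟨-, ψ, hψ, h3, h4⟩ := (memH10_iff _ _).1 hv
  have hc : ∀ {g : ℝ → ℝ} (hg : MemLp g ∞ (μ L)) {a : ℕ → L2 L} {w : L2 L},
      Tendsto a atTop (𝓝 w) → Tendsto (fun m => mulL2 hg (a m)) atTop (𝓝 (mulL2 hg w)) :=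
    fun hg _ w h => ((mulL2 hg).continuous.tendsto w).comp h
  refine tendsto_nhds_unique ((hc hf h1).inner h4) ?_
  simp_rw [fun m => htest _ _ (hφ m) (hψ m)]
  exact (((hc hfx h1).add (hc hf h2)).inner h3).neg

theorem memLp_top_of_sq_le {f : ℝ → ℝ} {C : ℝ} (hf : LocallyIntegrableOn f (Set.Ioo 0 L))
    (h : ∀ᵐ x ∂(μ L), f x ^ 2 ≤ C) : MemLp f ∞ (μ L) :=
  memLp_top_of_bound hf.aestronglyMeasurable (√C) (h.mono fun _ hx => Real.abs_le_sqrt hx)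

/-! ### Energy estimates for the scheme. -/

/-- The energy estimates for one time step, obtained by testing with `d` and with `p`. -/
theorem energy_estimate {f fx : ℝ → ℝ} {C : ℝ} (hf : MemLp f ∞ (μ L)) (hfx : MemLp fx ∞ (μ L))
    (hw : HasWeakDeriv L f fx) (hC : ∀ᵐ x ∂(μ L), 1 + f x ^ 2 + fx x ^ 2 ≤ C)
    {d dx p px h : L2 L} (hd : MemH10 L d dx) (hp : MemH10 L p px)
    (hs : ∀ v vx, MemH10 L v vx →
      inner ℝ d v + inner ℝ px vx - inner ℝ (mulL2 hf p) vx = inner ℝ h v) :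
    ‖d‖ ^ 2 + 2 * inner ℝ px dx ≤ 2 * ‖h‖ ^ 2 + 2 * C * (‖p‖ ^ 2 + ‖px‖ ^ 2) ∧
      2 * inner ℝ d p + ‖px‖ ^ 2 ≤ (C + 1) * ‖p‖ ^ 2 + ‖h‖ ^ 2 := by
  have young : ∀ a b : L2 L, 2 * inner ℝ a b ≤ ‖a‖ ^ 2 + ‖b‖ ^ 2 := fun a b => by
    have := norm_sub_sq_real a b
    nlinarith [sq_nonneg ‖a - b‖]
  constructor
  -- No bound on `‖dx‖` is available, so the drift flux is first integrated by parts and becomes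
  -- `z`, paired with `d`.
  · have h1 := hs d dx hd
    rw [inner_mulL2_deriv_eq_neg hf hfx hw hp hd, real_inner_self_eq_norm_sq] at h1
    set z := mulL2 hfx p + mulL2 hf px with hz
    have h2 := young (h - z) d
    have h3 : ‖h - z‖ ^ 2 ≤ 2 * ‖h‖ ^ 2 + 2 * ‖z‖ ^ 2 := by
      have := parallelogram_law_with_norm ℝ h z
      nlinarith [sq_nonneg ‖h + z‖]
    have h4 : ‖z‖ ^ 2 ≤ C * (‖p‖ ^ 2 + ‖px‖ ^ 2 + ‖(0 : L2 L)‖ ^ 2) := by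
      refine norm_sq_le_of_ae ?_
      filter_upwards [coeFn_mulL2 hfx p, coeFn_mulL2 hf px,
        Lp.coeFn_add (mulL2 hfx p) (mulL2 hf px), hC] with x h1 h2 h3 h4
      rw [hz, h3, Pi.add_apply, h1, h2]
      have h5 : (fx x * p x + f x * px x) ^ 2 ≤
          (f x ^ 2 + fx x ^ 2) * (p x ^ 2 + px x ^ 2) := by
        nlinarith [sq_nonneg (fx x * px x - f x * p x)]
      have h6 : (f x ^ 2 + fx x ^ 2) * (p x ^ 2 + px x ^ 2) ≤ C * (p x ^ 2 + px x ^ 2) :=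
        mul_le_mul_of_nonneg_right (by linarith) (by positivity)
      have h7 : 0 ≤ C * (0 : L2 L) x ^ 2 :=
        mul_nonneg (by nlinarith [sq_nonneg (f x), sq_nonneg (fx x)]) (sq_nonneg _)
      linarith
    rw [norm_zero] at h4
    rw [inner_sub_left] at h2
    linarith
  -- Here the drift can stay in flux form: Young's inequality absorbs half of `2‖px‖²`.
  · have h1 := hs p px hp
    rw [real_inner_self_eq_norm_sq] at h1
    have h2 := young (mulL2 hf p) px
    have h3 := young h p
    have h4 : ‖mulL2 hf p‖ ^ 2 ≤ C * (‖p‖ ^ 2 + ‖(0 : L2 L)‖ ^ 2 + ‖(0 : L2 L)‖ ^ 2) := by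
      refine norm_sq_le_of_ae ?_
      filter_upwards [coeFn_mulL2 hf p, hC] with x h1 h4
      rw [h1]
      have h6 : f x ^ 2 * p x ^ 2 ≤ C * p x ^ 2 :=
        mul_le_mul_of_nonneg_right (by nlinarith [sq_nonneg (fx x)]) (by positivity)
      have h7 : 0 ≤ C * (0 : L2 L) x ^ 2 :=
        mul_nonneg (by nlinarith [sq_nonneg (f x), sq_nonneg (fx x)]) (sq_nonneg _)
      nlinarith
    rw [norm_zero] at h4
    linarith

/-- Pointwise Cauchy–Schwarz for the vectors `(1, -fx, -f)` and `(uxx, u, ux)`; the `1` in the bound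
on the coefficients serves this estimate. -/
theorem norm_sub_mulL2_sq_le {f fx : ℝ → ℝ} {C : ℝ} (hf : MemLp f ∞ (μ L))
    (hfx : MemLp fx ∞ (μ L)) (hC : ∀ᵐ x ∂(μ L), 1 + f x ^ 2 + fx x ^ 2 ≤ C) (u ux uxx : L2 L) :
    ‖uxx - (mulL2 hfx u + mulL2 hf ux)‖ ^ 2 ≤ C * (‖u‖ ^ 2 + ‖ux‖ ^ 2 + ‖uxx‖ ^ 2) := by
  refine norm_sq_le_of_ae ?_
  filter_upwards [coeFn_mulL2 hfx u, coeFn_mulL2 hf ux,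
    Lp.coeFn_add (mulL2 hfx u) (mulL2 hf ux), Lp.coeFn_sub uxx (mulL2 hfx u + mulL2 hf ux), hC]
    with x h1 h2 h3 h4 h5
  rw [h4, Pi.sub_apply, h3, Pi.add_apply, h1, h2]
  have h6 : (uxx x - (fx x * u x + f x * ux x)) ^ 2 ≤
      (1 + f x ^ 2 + fx x ^ 2) * (u x ^ 2 + ux x ^ 2 + uxx x ^ 2) := by
    nlinarith [sq_nonneg (fx x * ux x - f x * u x), sq_nonneg (uxx x * fx x + u x),
      sq_nonneg (uxx x * f x + ux x)]
  exact h6.trans (mul_le_mul_of_nonneg_right h5 (by positivity))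

/-- The scheme in terms of the increments `Uⁿ - Uⁿ⁻¹`, with the contribution of `U⁰` moved to the
right-hand side. -/
theorem SolvesScheme.increment_form {α k : ℝ} {N : ℕ} {F Fx : ℝ → ℝ → ℝ} {g U Ux : ℕ → L2 L}
    {U0xx : L2 L} (hα : 0 < α) (hk : 0 < k) (h0 : HasWeakDeriv L (Ux 0) U0xx)
    (h : SolvesScheme α L k N F g U Ux) {m : ℕ} (hm : m < N)
    (hf : MemLp (fun x => F x ((m + 1 : ℕ) * k)) ∞ (μ L))
    (hfx : MemLp (fun x => Fx x ((m + 1 : ℕ) * k)) ∞ (μ L))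
    (hw : HasWeakDeriv L (fun x => F x ((m + 1 : ℕ) * k)) (fun x => Fx x ((m + 1 : ℕ) * k)))
    {v vx : L2 L} (hv : MemH10 L v vx) :
    inner ℝ (U (m + 1) - U m) v +
      inner ℝ (∑ j ∈ Finset.range (m + 1), weight α k (m - j) • (Ux (j + 1) - Ux j)) vx -
      inner ℝ (mulL2 hf (∑ j ∈ Finset.range (m + 1), weight α k (m - j) • (U (j + 1) - U j))) vx =
    inner ℝ (k • g (m + 1) + weight α k m • (U0xx - (mulL2 hfx (U 0) + mulL2 hf (Ux 0)))) v := by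
  have h1 := h.2 (m + 1) (by omega) hm v vx hv
  have e : ((m + 1 : ℕ) : ℝ) - 1 = m := by push_cast; ring
  rw [e, integral_fracDeriv_check hα hk, integral_fracDeriv_check hα hk, sum_weight_smul_abel,
    sum_weight_smul_abel, ← inner_mulL2 hf, Nat.add_sub_cancel, map_add, map_smul, inner_add_left,
    inner_add_left, real_inner_smul_left, real_inner_smul_left, hv.inner_deriv_eq_neg h0,
    inner_mulL2_deriv_eq_neg hf hfx hw (h.1 0 (Nat.zero_le N)) hv] at h1
  rw [inner_add_left, real_inner_smul_left, real_inner_smul_left, inner_sub_left U0xx]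
  linarith

/-- The sum of the squared increments satisfies a discrete fractional integral inequality. -/
theorem sum_norm_sq_le_of_energy {α k C : ℝ} (hα : 0 < α) (hα1 : α ≤ 1) (hk : 0 < k) (hC : 0 ≤ C)
    {E : Type*} [NormedAddCommGroup E] [InnerProductSpace ℝ E] (D Dx P Px H : ℕ → E) (n : ℕ)
    (hP : ∀ m, P m = ∑ j ∈ Finset.range (m + 1), weight α k (m - j) • D j)
    (hPx : ∀ m, Px m = ∑ j ∈ Finset.range (m + 1), weight α k (m - j) • Dx j)
    (h1 : ∀ m < n, ‖D m‖ ^ 2 + 2 * inner ℝ (Px m) (Dx m) ≤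
      2 * ‖H m‖ ^ 2 + 2 * C * (‖P m‖ ^ 2 + ‖Px m‖ ^ 2))
    (h2 : ∀ m < n, 2 * inner ℝ (D m) (P m) + ‖Px m‖ ^ 2 ≤ (C + 1) * ‖P m‖ ^ 2 + ‖H m‖ ^ 2) :
    ∑ m ∈ Finset.range n, ‖D m‖ ^ 2 ≤ (2 + 2 * C) * ∑ m ∈ Finset.range n, ‖H m‖ ^ 2 +
      2 * C * (C + 2) * ((n * k) ^ α / Real.Gamma (α + 1)) * ∑ m ∈ Finset.range n,
        weight α k (n - 1 - m) * ∑ j ∈ Finset.range (m + 1), ‖D j‖ ^ 2 := by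
  have hw := weight_nonneg (k := k) hα hk.le
  have hpos : ∀ d : ℕ → E, 0 ≤ ∑ m ∈ Finset.range n,
      inner ℝ (∑ j ∈ Finset.range (m + 1), weight α k (m - j) • d j) (d m) := fun d =>
    sum_inner_conv_nonneg _ hw (weight_succ_le hα hα1 hk.le) (weight_convex hα hα1 hk.le) d n
  have p1 := hpos D
  have p2 := hpos Dx
  have p3 := sum_norm_conv_sq_le _ hw D n
  simp_rw [← hP, sum_weight hα] at p1 p3
  simp_rw [← hPx] at p2
  have s1 := Finset.sum_le_sum fun m hm => h1 m (Finset.mem_range.1 hm)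
  have s2 := Finset.sum_le_sum fun m hm => h2 m (Finset.mem_range.1 hm)
  simp only [Finset.sum_add_distrib, ← Finset.mul_sum, real_inner_comm] at s1 s2 p1 p2
  have s3 := mul_le_mul_of_nonneg_left s2 hC
  have s4 := mul_le_mul_of_nonneg_left p3 (show 0 ≤ 2 * C * (C + 2) by positivity)
  -- The `P`-test is used `2C` times to remove `‖Px‖²`, whence `2 + 2C` and `2C + 2C(C+1) =
  -- 2C(C+2)`.
  have s5 := mul_nonneg hC p1
  nlinarith

theorem exists_stepsize_bound {α T K : ℝ} (hα : 0 < α) (hT : 0 < T) (hK : 0 < K) :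
    ∃ k₀ : ℝ, 0 < k₀ ∧ ∀ k t : ℝ, 0 < k → k ≤ k₀ → 0 ≤ t → t ≤ T →
      K * (t ^ α / Real.Gamma (α + 1)) * weight α k 0 ≤ 1 / 2 := by
  have hΓ : 0 < Real.Gamma (α + 1) := Real.Gamma_pos_of_pos (by linarith)
  -- Chosen so that `t = T` and `k^α = A` give exactly `1/2`.
  set A := Real.Gamma (α + 1) ^ 2 / (2 * K * T ^ α) with hA
  have hTα : 0 < T ^ α := by positivity
  have hA0 : 0 < A := by positivity
  refine ⟨A ^ (1 / α), by positivity, fun k t hk hk0 ht htT => ?_⟩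
  have hkA : k ^ α ≤ A := by
    have := Real.rpow_le_rpow hk.le hk0 hα.le
    rwa [← Real.rpow_mul hA0.le, one_div_mul_cancel hα.ne', Real.rpow_one] at this
  have hw : weight α k 0 = k ^ α / Real.Gamma (α + 1) := by
    simp [weight_eq hα, Real.zero_rpow hα.ne']
  rw [hw]
  calc K * (t ^ α / Real.Gamma (α + 1)) * (k ^ α / Real.Gamma (α + 1))
      ≤ K * (T ^ α / Real.Gamma (α + 1)) * (A / Real.Gamma (α + 1)) := by gcongr
    _ = 1 / 2 := by rw [hA]; field_simp

theorem norm_sub_zero_sq_le {E : Type*} [NormedAddCommGroup E] (U : ℕ → E) (n : ℕ) :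
    ‖U n - U 0‖ ^ 2 ≤ n * ∑ j ∈ Finset.range n, ‖U (j + 1) - U j‖ ^ 2 := by
  rw [← Finset.sum_range_sub]
  refine (pow_le_pow_left₀ (norm_nonneg _) (norm_sum_le _ _) 2).trans ?_
  simpa using sq_sum_le_card_mul_sum_sq (s := Finset.range n) (f := fun j => ‖U (j + 1) - U j‖)

/-- The energy estimates for the increments of a solution of the scheme, with a forcing term
controlled by the data. -/
theorem SolvesScheme.exists_energy_estimate {α k C : ℝ} {N : ℕ} {F Fx : ℝ → ℝ → ℝ}
    {g U Ux : ℕ → L2 L} {U0xx : L2 L} (hα : 0 < α) (hk : 0 < k)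
    (h0 : HasWeakDeriv L (Ux 0) U0xx) (hS : SolvesScheme α L k N F g U Ux) {m : ℕ} (hm : m < N)
    (hw : HasWeakDeriv L (fun x => F x ((m + 1 : ℕ) * k)) (fun x => Fx x ((m + 1 : ℕ) * k)))
    (hC : ∀ᵐ x ∂(μ L), 1 + F x ((m + 1 : ℕ) * k) ^ 2 + Fx x ((m + 1 : ℕ) * k) ^ 2 ≤ C)
    (D Dx P Px : ℕ → L2 L) (hD : ∀ j, D j = U (j + 1) - U j) (hDx : ∀ j, Dx j = Ux (j + 1) - Ux j)
    (hP : ∀ m, P m = ∑ j ∈ Finset.range (m + 1), weight α k (m - j) • D j)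
    (hPx : ∀ m, Px m = ∑ j ∈ Finset.range (m + 1), weight α k (m - j) • Dx j) :
    ∃ h : L2 L, ‖h‖ ^ 2 ≤ 2 * (k ^ 2 * ‖g (m + 1)‖ ^ 2) +
        2 * (weight α k m ^ 2 * (C * (‖U 0‖ ^ 2 + ‖Ux 0‖ ^ 2 + ‖U0xx‖ ^ 2))) ∧
      ‖D m‖ ^ 2 + 2 * inner ℝ (Px m) (Dx m) ≤
        2 * ‖h‖ ^ 2 + 2 * C * (‖P m‖ ^ 2 + ‖Px m‖ ^ 2) ∧
      2 * inner ℝ (D m) (P m) + ‖Px m‖ ^ 2 ≤ (C + 1) * ‖P m‖ ^ 2 + ‖h‖ ^ 2 := by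
  have hf : MemLp (fun x => F x ((m + 1 : ℕ) * k)) ∞ (μ L) :=
    memLp_top_of_sq_le (C := C) hw.1 <| hC.mono fun x hx => by
      nlinarith [sq_nonneg (Fx x ((m + 1 : ℕ) * k))]
  have hfx : MemLp (fun x => Fx x ((m + 1 : ℕ) * k)) ∞ (μ L) :=
    memLp_top_of_sq_le (C := C) hw.2.1 <| hC.mono fun x hx => by
      nlinarith [sq_nonneg (F x ((m + 1 : ℕ) * k))]
  have hDm : ∀ j < N, MemH10 L (D j) (Dx j) := fun j hj => by
    rw [hD, hDx]; exact (hS.1 (j + 1) hj).sub (hS.1 j hj.le)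
  have hPm : MemH10 L (P m) (Px m) := by
    rw [hP, hPx]
    exact MemH10.sum _ fun j hj =>
      (hDm j (by have := Finset.mem_range.1 hj; omega)).const_smul _
  have hz := norm_sub_mulL2_sq_le hf hfx hC (U 0) (Ux 0) U0xx
  refine ⟨k • g (m + 1) + weight α k m • (U0xx - (mulL2 hfx (U 0) + mulL2 hf (Ux 0))), ?_,
    energy_estimate hf hfx hw hC (hDm m hm) hPm fun v vx hv => ?_⟩
  · set z := U0xx - (mulL2 hfx (U 0) + mulL2 hf (Ux 0))
    have hpar := parallelogram_law_with_norm ℝ (k • g (m + 1)) (weight α k m • z)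
    have e1 : ‖k • g (m + 1)‖ ^ 2 = k ^ 2 * ‖g (m + 1)‖ ^ 2 := by
      rw [norm_smul, mul_pow, Real.norm_eq_abs, sq_abs]
    have e2 : ‖weight α k m • z‖ ^ 2 = weight α k m ^ 2 * ‖z‖ ^ 2 := by
      rw [norm_smul, mul_pow, Real.norm_eq_abs, sq_abs]
    have e3 := mul_le_mul_of_nonneg_left hz (sq_nonneg (weight α k m))
    have e4 := sq_nonneg ‖k • g (m + 1) - weight α k m • z‖
    linarith
  · have h := hS.increment_form hα hk h0 hm hf hfx hw hv
    simp only [← hD, ← hDx, ← hP, ← hPx] at h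
    exact h

/-- The energy estimates for the increments imply a bound for the solution. -/
theorem norm_sub_zero_sq_le_of_energy {α k C : ℝ} (hα : 1 / 2 < α) (hα1 : α ≤ 1) (hk : 0 < k)
    (hC : 0 ≤ C) {E : Type*} [NormedAddCommGroup E] [InnerProductSpace ℝ E]
    (U D Dx P Px H : ℕ → E) {n : ℕ} (hn : 1 ≤ n) (hD : ∀ j, D j = U (j + 1) - U j)
    (hP : ∀ m, P m = ∑ j ∈ Finset.range (m + 1), weight α k (m - j) • D j)
    (hPx : ∀ m, Px m = ∑ j ∈ Finset.range (m + 1), weight α k (m - j) • Dx j)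
    (h1 : ∀ m < n, ‖D m‖ ^ 2 + 2 * inner ℝ (Px m) (Dx m) ≤
      2 * ‖H m‖ ^ 2 + 2 * C * (‖P m‖ ^ 2 + ‖Px m‖ ^ 2))
    (h2 : ∀ m < n, 2 * inner ℝ (D m) (P m) + ‖Px m‖ ^ 2 ≤ (C + 1) * ‖P m‖ ^ 2 + ‖H m‖ ^ 2)
    (hck : 2 * C * (C + 2) * ((n * k) ^ α / Real.Gamma (α + 1)) * weight α k 0 ≤ 1 / 2) :
    ‖U n - U 0‖ ^ 2 ≤ n * (2 * ((2 + 2 * C) * ∑ m ∈ Finset.range n, ‖H m‖ ^ 2) *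
      mittagLeffler α (4 * C * (C + 2) * (n * k) ^ (2 * α) / Real.Gamma (α + 1))) := by
  have hα0 : 0 < α := by linarith
  have hΓ : 0 < Real.Gamma (α + 1) := Real.Gamma_pos_of_pos (by linarith)
  have ht0 : 0 < n * k := by
    have : (0 : ℝ) < n := by exact_mod_cast hn
    positivity
  set c := 2 * C * (C + 2) * ((n * k) ^ α / Real.Gamma (α + 1)) with hc
  -- The estimate up to time `m + 1`, with its coefficient and forcing enlarged to those at time
  -- `n`, since Gronwall requires constants.
  have hint : ∀ m < n, ∑ j ∈ Finset.range (m + 1), ‖D j‖ ^ 2 ≤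
      (2 + 2 * C) * ∑ m ∈ Finset.range n, ‖H m‖ ^ 2 + c * ∑ j ∈ Finset.range (m + 1),
        weight α k (m - j) * ∑ i ∈ Finset.range (j + 1), ‖D i‖ ^ 2 := by
    intro m hm
    refine (sum_norm_sq_le_of_energy hα0 hα1 hk hC D Dx P Px H (m + 1) hP hPx
      (fun j hj => h1 j (by omega)) fun j hj => h2 j (by omega)).trans (add_le_add
        (mul_le_mul_of_nonneg_left ?_ (by linarith)) (mul_le_mul_of_nonneg_right ?_ ?_))
    · exact Finset.sum_le_sum_of_subset_of_nonneg (Finset.range_mono hm) fun _ _ _ => by positivity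
    · have : ((m + 1 : ℕ) : ℝ) ≤ n := by exact_mod_cast hm
      rw [hc]
      gcongr
    · exact Finset.sum_nonneg fun j _ => mul_nonneg (weight_nonneg hα0 hk.le _) (by positivity)
  have hG := fractional_gronwall hα hα1 hk (by positivity) (by positivity) hck _ n
    (fun m _ => by positivity) hint (n - 1) (by omega)
  rw [Nat.sub_add_cancel hn] at hG
  have e : 2 * c * (n * k) ^ α = 4 * C * (C + 2) * (n * k) ^ (2 * α) / Real.Gamma (α + 1) := by
    rw [two_mul α, Real.rpow_add ht0, hc]; ring
  rw [e] at hG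
  refine (norm_sub_zero_sq_le U n).trans (mul_le_mul_of_nonneg_left ?_ (by positivity))
  simpa only [hD] using hG

/-- Both contributions release a factor `k`: the source as `k² = k * k`, the initial datum through
`sum_sq_weight_le`, which relies on `α > 1/2`. -/
theorem sum_norm_sq_forcing_le {α k C M : ℝ} (hα : 1 / 2 < α) (hα1 : α ≤ 1) (hk : 0 < k)
    (hC : 0 ≤ C) (hM : 0 ≤ M) {E : Type*} [NormedAddCommGroup E] (g H : ℕ → E) (n : ℕ)
    (hH : ∀ m < n, ‖H m‖ ^ 2 ≤
      2 * (k ^ 2 * ‖g (m + 1)‖ ^ 2) + 2 * (weight α k m ^ 2 * (C * M))) :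
    ∑ m ∈ Finset.range n, ‖H m‖ ^ 2 ≤ k * (2 * ∑ j ∈ Finset.Icc 1 n, k * ‖g j‖ ^ 2 +
      2 * (C * M) * ((n * k) ^ (2 * α - 1) / (2 * α - 1))) := by
  have h1 : k ^ 2 * ∑ m ∈ Finset.range n, ‖g (m + 1)‖ ^ 2 =
      k * ∑ j ∈ Finset.Icc 1 n, k * ‖g j‖ ^ 2 := by
    rw [Finset.mul_sum, Finset.mul_sum, Finset.range_eq_Ico,
      Finset.sum_Ico_add' (fun j => k ^ 2 * ‖g j‖ ^ 2) 0 n 1]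
    refine Finset.sum_congr (by ext; simp) fun j _ => by ring
  have h2 := mul_le_mul_of_nonneg_right (sum_sq_weight_le hα hα1 hk n)
    (show 0 ≤ C * M by positivity)
  have h3 := Finset.sum_le_sum fun m hm => hH m (Finset.mem_range.1 hm)
  simp only [Finset.sum_add_distrib, ← Finset.mul_sum, ← Finset.sum_mul] at h3
  linarith

end TimeFracFP

end

/-! ### Assembly and comparison of constants. -/

theorem theorem4p3 (α T C_F : ℝ) (hα : 1 / 2 < α) (hα1 : α ≤ 1) (hT : 0 < T) :
    ∃ k₀ : ℝ, 0 < k₀ ∧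
      ∀ (L k : ℝ) (N : ℕ), 0 < L → 0 < k → k ≤ k₀ → (N : ℝ) * k = T →
      ∀ (F Fx : ℝ → ℝ → ℝ),
      -- `F(·, t_n)` has the weak derivative `Fx(·, t_n)`, and both are bounded
      (∀ n : ℕ, 1 ≤ n → n ≤ N →
        TimeFracFP.HasWeakDeriv L (fun x => F x (n * k)) (fun x => Fx x (n * k)) ∧
        ∀ᵐ x ∂(TimeFracFP.μ L), 1 + F x (n * k) ^ 2 + Fx x (n * k) ^ 2 ≤ C_F) →
      ∀ (g U Ux : ℕ → TimeFracFP.L2 L) (U0xx : TimeFracFP.L2 L),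
      -- `U 0` lies in `H¹₀ ∩ H²`, with second derivative `U0xx`
      TimeFracFP.HasWeakDeriv L (Ux 0) U0xx →
      TimeFracFP.SolvesScheme α L k N F g U Ux →
      ∀ n : ℕ, 1 ≤ n → n ≤ N →
        ‖U n - U 0‖ ^ 2 ≤
          (n * k) *
            TimeFracFP.mittagLeffler α
              ((24 * C_F * (1 + 2 * C_F)) * (n * k) ^ (2 * α) / Real.Gamma (α + 1)) *
            ((6 * (1 + 2 * C_F)) * ∑ j ∈ Finset.Icc 1 n, k * ‖g j‖ ^ 2
              + (6 * C_F * (1 + 4 * C_F)) * (‖U 0‖ ^ 2 + ‖Ux 0‖ ^ 2 + ‖U0xx‖ ^ 2) *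
                (1 + (n * k) ^ (2 * α - 1) / (2 * α - 1))) := by
  have hα0 : 0 < α := by linarith
  -- `k₀` is fixed before any `F` is given, hence before `C_F ≥ 1` can be read off at a point of
  -- `Ω`; the maximum keeps the choice meaningful for every `C_F`.
  have hmax : (0 : ℝ) < max C_F 1 := lt_max_of_lt_right one_pos
  obtain ⟨k₀, hk₀, hstep⟩ := TimeFracFP.exists_stepsize_bound (K := 2 * max C_F 1 * (max C_F 1 + 2))
    hα0 hT (by positivity)
  refine ⟨k₀, hk₀, fun L k N hL hk hkk hN F Fx hF g U Ux U0xx h0 hS n hn hnN => ?_⟩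
  have hC : 1 ≤ C_F := by
    have : NeZero (TimeFracFP.μ L) := ⟨by simp [TimeFracFP.μ, hL]⟩
    obtain ⟨x, hx⟩ := (hF n hn hnN).2.exists
    nlinarith [sq_nonneg (F x (n * k)), sq_nonneg (Fx x (n * k))]
  rw [max_eq_left hC] at hstep
  have hnk : 0 ≤ n * k := by positivity
  have hΓ : 0 < Real.Gamma (α + 1) := Real.Gamma_pos_of_pos (by linarith)
  have hex : ∀ m : ℕ, ∃ h : TimeFracFP.L2 L, m < N → _ := fun m => by
    by_cases hm : m < N
    · exact (TimeFracFP.SolvesScheme.exists_energy_estimate hα0 hk h0 hS hm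
        (hF (m + 1) (by omega) hm).1 (hF (m + 1) (by omega) hm).2 _ _ _ _ (fun _ => rfl)
        (fun _ => rfl) (fun _ => rfl) (fun _ => rfl)).imp fun _ h _ => h
    · exact ⟨0, fun h => absurd h hm⟩
  choose H hH using hex
  have hHsum := TimeFracFP.sum_norm_sq_forcing_le hα hα1 hk (by linarith) (by positivity) g H n
    fun m hm => (hH m (hm.trans_le hnN)).1
  have hbound := TimeFracFP.norm_sub_zero_sq_le_of_energy hα hα1 hk (by linarith) U _ _ _ _ H hn
    (fun _ => rfl) (fun _ => rfl) (fun _ => rfl) (fun m hm => (hH m (hm.trans_le hnN)).2.1)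
    (fun m hm => (hH m (hm.trans_le hnN)).2.2)
    (hstep k (n * k) hk hkk hnk (by rw [← hN]; gcongr))
  have hML : TimeFracFP.mittagLeffler α
        (4 * C_F * (C_F + 2) * (n * k) ^ (2 * α) / Real.Gamma (α + 1)) ≤
      TimeFracFP.mittagLeffler α
        ((24 * C_F * (1 + 2 * C_F)) * (n * k) ^ (2 * α) / Real.Gamma (α + 1)) := by
    refine TimeFracFP.mittagLeffler_mono hα (by positivity) ?_
    have : 4 * C_F * (C_F + 2) ≤ 24 * C_F * (1 + 2 * C_F) := by nlinarith
    gcongr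
  have hQ : 0 ≤ (n * k) ^ (2 * α - 1) / (2 * α - 1) := div_nonneg (by positivity) (by linarith)
  have hG : 0 ≤ ∑ j ∈ Finset.Icc 1 n, k * ‖g j‖ ^ 2 := by positivity
  have hM : 0 ≤ ‖U 0‖ ^ 2 + ‖Ux 0‖ ^ 2 + ‖U0xx‖ ^ 2 := by positivity
  have hY : 0 ≤ TimeFracFP.mittagLeffler α
      (4 * C_F * (C_F + 2) * (n * k) ^ (2 * α) / Real.Gamma (α + 1)) :=
    TimeFracFP.mittagLeffler_nonneg hα0 (by positivity)
  have hX : 0 ≤ TimeFracFP.mittagLeffler α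
      ((24 * C_F * (1 + 2 * C_F)) * (n * k) ^ (2 * α) / Real.Gamma (α + 1)) :=
    TimeFracFP.mittagLeffler_nonneg hα0 (by positivity)
  have hS0 : 0 ≤ ∑ m ∈ Finset.range n, ‖H m‖ ^ 2 := by positivity
  generalize ∑ m ∈ Finset.range n, ‖H m‖ ^ 2 = S at *
  generalize TimeFracFP.mittagLeffler α
    ((24 * C_F * (1 + 2 * C_F)) * (n * k) ^ (2 * α) / Real.Gamma (α + 1)) = X at *
  generalize ∑ j ∈ Finset.Icc 1 n, k * ‖g j‖ ^ 2 = G at *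
  generalize ‖U 0‖ ^ 2 + ‖Ux 0‖ ^ 2 + ‖U0xx‖ ^ 2 = M at *
  generalize (n * k) ^ (2 * α - 1) / (2 * α - 1) = Q at *
  clear hH hF hS hstep h0
  -- The argument yields `8 + 8C` and `C(8 + 8C)`; with `C ≥ 1` these are below the stated `C₂` and
  -- `C₃`.
  calc ‖U n - U 0‖ ^ 2
      ≤ n * (2 * ((2 + 2 * C_F) * (k * (2 * G + 2 * (C_F * M) * Q))) * X) :=
        hbound.trans (by gcongr)
    _ = n * k * X * ((8 + 8 * C_F) * G + C_F * (8 + 8 * C_F) * M * Q) := by ring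
    _ ≤ _ := by
        have h1 : (8 + 8 * C_F) * G ≤ 6 * (1 + 2 * C_F) * G :=
          mul_le_mul_of_nonneg_right (by linarith) hG
        have h2 : C_F * (8 + 8 * C_F) ≤ 6 * C_F * (1 + 4 * C_F) := by nlinarith
        have h3 : C_F * (8 + 8 * C_F) * M * Q ≤ 6 * C_F * (1 + 4 * C_F) * M * (1 + Q) :=
          mul_le_mul (mul_le_mul_of_nonneg_right h2 hM) (by linarith) hQ (by positivity)
        exact mul_le_mul_of_nonneg_left (add_le_add h1 h3) (mul_nonneg hnk hX)
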